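/- For an integer $X\ge 0$ let $m=m_X=\prod_{l\le X,\ l\ \text{prime}} l$, let $\zeta_m$ be a primitive $m$-th root of unity, $K=\mathbb Q(\zeta_m)$ with ring of integers $\mathcal O_K=\mathbb Z[\zeta_m]$, and let $\phi$ be Euler's function. Equip $K_{\mathbb R}=K\otimes_{\mathbb Q}\mathbb R$ with the scalar product $\langle x,y\rangle=\operatorname{tr}(x\bar y)$ and $E=K_{\mathbb R}^2$ with $\langle x,y\rangle=\langle x_1,y_1\rangle+\langle x_2,y_2\rangle$, so that $E$ is a Euclidean space of dimension $n=2\phi(m)$. For a prime ideal $\mathfrak P$ of $\mathcal O_K$ lying over a prime number that does not divide $m$, put $F=\mathcal O_K/\mathfrak P$; for an $F$-line (one-dimensional subspace) $C\subset F^2$ let $\Lambda_C\subset E$ be the preimage of $C$ under the coordinatewise reduction $\mathcal O_K^2\to F^2$, and let $\mathcal L_{\mathcal C}=\mathcal L_{\mathcal C}(\mathfrak P)$ be the set of the lattices $\Lambda_C$, $C$ running over the $F$-lines of $F^2$. The density of a lattice $\Lambda\subset E$ is $\Delta(\Lambda)=\operatorname{Vol}(B(\mu))/(2^n\operatorname{Vol}(\Lambda))$,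 where $\mu$ is the minimum norm of the nonzero vectors of $\Lambda$, $B(\mu)$ is the closed ball of radius $\mu$, and $\operatorname{Vol}(\Lambda)$ is the volume of a fundamental region of $\Lambda$. Choose for every integer $X\ge 0$ a prime ideal $\mathfrak P_X$ of $\mathbb Z[\zeta_{m_X}]$ lying over a prime number that does not divide $m_X$, in such a way that, with $q_X=|\mathbb Z[\zeta_{m_X}]/\mathfrak P_X|$, $$\phi(m_X)^2\,m_X=o\big(q_X^{1/\phi(m_X)}\big)\qquad (X\to\infty).$$ Such choices exist, and for every such choice and all sufficiently large $X$ the family $\mathcal L_{\mathcal C}(\mathfrak P_X)$ contains a lattice $\Lambda\subset E\cong\mathbb R^n$, $n=2\phi(m_X)$, with $$\Delta(\Lambda)\ \ge\ \frac{0.89\,n\log\log n}{2^n}.$$ In particular this holds for infinitely many dimensions $n$. -/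

import Mathlib

open Filter Topology MeasureTheory Asymptotics NumberField
open scoped TensorProduct ComplexConjugate

noncomputable section

/-! ### Lattices in Euclidean spaces -/

section Lattices

variable {E : Type*} [NormedAddCommGroup E] [InnerProductSpace ℝ E]

/-- A lattice of `E`: a discrete subgroup that spans `E` over `ℝ`. -/
def IsEuclideanLattice (L : Submodule ℤ E) : Prop :=
  DiscreteTopology L ∧ Submodule.span ℝ (L : Set E) = ⊤

/-- The minimum of a lattice: the least norm of a nonzero vector. -/
def latticeMinimum (L : Submodule ℤ E) : ℝ :=
  sInf {r : ℝ | ∃ x ∈ L, x ≠ 0 ∧ r = ‖x‖}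

/-- The density of the sphere packing of a lattice `L` in a Euclidean space `E` of dimension `n`,
that is `Vol (B (μ)) / (2 ^ n * Vol (L))`, where `μ` is the minimum of `L`, the measure is the
Lebesgue measure of the Euclidean space `E`, and `Vol (L)` is the volume of a fundamental
region of `L`. -/
def latticeDensity [FiniteDimensional ℝ E] [MeasurableSpace E] [BorelSpace E]
    (L : Submodule ℤ E) : ℝ :=
  (volume : Measure E).real (Metric.closedBall 0 (latticeMinimum L)) /
    (2 ^ Module.finrank ℝ E * ZLattice.covolume L volume)

end Lattices

/-! ### The Euclidean space attached to a cyclotomic field -/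

section Cyclotomic

variable (m : ℕ) [NeZero m]

instance cyclotomicField_isCyclotomicExtension :
    IsCyclotomicExtension {m} ℚ (CyclotomicField m ℚ) := by
  have h : (DivisionRing.toRatAlgebra : Algebra ℚ (CyclotomicField m ℚ)) =
    CyclotomicField.algebra m ℚ := Subsingleton.elim _ _
  rw [h]
  exact CyclotomicField.isCyclotomicExtension m ℚ

/-- Complex conjugation of `ℚ(ζ_m)`: the automorphism that sends `ζ_m` to `ζ_m⁻¹`. -/
def cyclotomicConj : CyclotomicField m ℚ ≃ₐ[ℚ] CyclotomicField m ℚ :=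
  IsCyclotomicExtension.fromZetaAut
    (IsCyclotomicExtension.zeta_spec m ℚ (CyclotomicField m ℚ)).inv
    (Polynomial.cyclotomic.irreducible_rat (NeZero.pos m))

theorem cyclotomicConj_zeta :
    cyclotomicConj m (IsCyclotomicExtension.zeta m ℚ (CyclotomicField m ℚ)) =
      (IsCyclotomicExtension.zeta m ℚ (CyclotomicField m ℚ))⁻¹ :=
  IsCyclotomicExtension.fromZetaAut_spec _ _

theorem embedding_cyclotomicConj (φ : CyclotomicField m ℚ →+* ℂ) (x : CyclotomicField m ℚ) :
    φ (cyclotomicConj m x) = conj (φ x) := by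
  have hζ := IsCyclotomicExtension.zeta_spec m ℚ (CyclotomicField m ℚ)
  have key : (φ.toRatAlgHom.comp (cyclotomicConj m : _ →ₐ[ℚ] _)) =
      ((starRingEnd ℂ).comp φ).toRatAlgHom := by
    apply (hζ.powerBasis ℚ).algHom_ext
    have h1 : φ (IsCyclotomicExtension.zeta m ℚ (CyclotomicField m ℚ)) ^ m = 1 := by
      rw [← map_pow, hζ.pow_eq_one, map_one]
    have h2 := Complex.norm_eq_one_of_pow_eq_one h1 (NeZero.ne m)
    simpa [cyclotomicConj_zeta] using Complex.inv_eq_conj h2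
  exact DFunLike.congr_fun key x

/-- The real algebra `ℚ(ζ_m) ⊗ ℝ`. -/
def CyclotomicRealSpace : Type := ℝ ⊗[ℚ] CyclotomicField m ℚ

namespace CyclotomicRealSpace

instance : CommRing (CyclotomicRealSpace m) :=
  inferInstanceAs (CommRing (ℝ ⊗[ℚ] CyclotomicField m ℚ))

instance : Algebra ℝ (CyclotomicRealSpace m) :=
  inferInstanceAs (Algebra ℝ (ℝ ⊗[ℚ] CyclotomicField m ℚ))

instance : Module.Finite ℝ (CyclotomicRealSpace m) :=
  inferInstanceAs (Module.Finite ℝ (ℝ ⊗[ℚ] CyclotomicField m ℚ))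

/-- The natural embedding of `ℚ(ζ_m)` into `ℚ(ζ_m) ⊗ ℝ`. -/
def of : CyclotomicField m ℚ →+* CyclotomicRealSpace m :=
  (Algebra.TensorProduct.includeRight :
    CyclotomicField m ℚ →ₐ[ℚ] ℝ ⊗[ℚ] CyclotomicField m ℚ).toRingHom

/-- Complex conjugation, extended `ℝ`-linearly to `ℚ(ζ_m) ⊗ ℝ`. -/
def conjugate : CyclotomicRealSpace m →ₐ[ℝ] CyclotomicRealSpace m :=
  (Algebra.TensorProduct.map (AlgHom.id ℝ ℝ) (cyclotomicConj m : _ →ₐ[ℚ] _) :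
    ℝ ⊗[ℚ] CyclotomicField m ℚ →ₐ[ℝ] ℝ ⊗[ℚ] CyclotomicField m ℚ)

/-- The trace form `tr (x * conj y)` on `ℚ(ζ_m) ⊗ ℝ`. -/
def traceForm (x y : CyclotomicRealSpace m) : ℝ :=
  Algebra.trace ℝ (CyclotomicRealSpace m) (x * conjugate m y)

/-- The `ℝ`-linear extension of a complex embedding of `ℚ(ζ_m)`. -/
def extendEmbedding (φ : CyclotomicField m ℚ →+* ℂ) : CyclotomicRealSpace m →ₐ[ℝ] ℂ :=
  (Algebra.TensorProduct.lift (Algebra.ofId ℝ ℂ) φ.toRatAlgHom (fun _ _ => Commute.all _ _) :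
    ℝ ⊗[ℚ] CyclotomicField m ℚ →ₐ[ℝ] ℂ)

theorem extendEmbedding_tmul (φ : CyclotomicField m ℚ →+* ℂ) (r : ℝ) (k : CyclotomicField m ℚ) :
    extendEmbedding m φ (r ⊗ₜ[ℚ] k : ℝ ⊗[ℚ] CyclotomicField m ℚ) = r * φ k := by
  erw [Algebra.TensorProduct.lift_tmul]
  rfl

theorem extendEmbedding_conjugate (φ : CyclotomicField m ℚ →+* ℂ) (x : CyclotomicRealSpace m) :
    extendEmbedding m φ (conjugate m x) = conj (extendEmbedding m φ x) := by
  refine TensorProduct.induction_on (motive := fun z : ℝ ⊗[ℚ] CyclotomicField m ℚ =>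
    extendEmbedding m φ (conjugate m z) = conj (extendEmbedding m φ z)) x ?_ ?_ ?_
  · exact (map_zero ((extendEmbedding m φ).comp (conjugate m))).trans
      (by erw [map_zero (extendEmbedding m φ)]; simp)
  · intro r k
    have h : conjugate m (r ⊗ₜ[ℚ] k : ℝ ⊗[ℚ] CyclotomicField m ℚ) =
      (r ⊗ₜ[ℚ] cyclotomicConj m k : ℝ ⊗[ℚ] CyclotomicField m ℚ) := rfl
    rw [h, extendEmbedding_tmul, extendEmbedding_tmul, embedding_cyclotomicConj]
    simp
  · intro a b ha hb
    have h1 := map_add (extendEmbedding m φ) a b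
    have h2 := map_add (conjugate m) a b
    erw [h2, map_add, h1, map_add, ha, hb]
    rfl

theorem trace_tmul (r : ℝ) (k : CyclotomicField m ℚ) :
    Algebra.trace ℝ (CyclotomicRealSpace m) (r ⊗ₜ[ℚ] k : ℝ ⊗[ℚ] CyclotomicField m ℚ) =
      r * (Algebra.trace ℚ (CyclotomicField m ℚ) k : ℚ) := by
  have h : Algebra.lmul ℝ (ℝ ⊗[ℚ] CyclotomicField m ℚ) (r ⊗ₜ[ℚ] k) =
      r • (Algebra.lmul ℚ (CyclotomicField m ℚ) k).baseChange ℝ := by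
    ext; simp [TensorProduct.smul_tmul']
  have h' := congrArg (LinearMap.trace ℝ (ℝ ⊗[ℚ] CyclotomicField m ℚ)) h
  rw [map_smul, LinearMap.trace_baseChange] at h'
  exact h'

theorem trace_eq_sum (x : CyclotomicRealSpace m) :
    (Algebra.trace ℝ (CyclotomicRealSpace m) x : ℂ) =
      ∑ φ : CyclotomicField m ℚ →+* ℂ, extendEmbedding m φ x := by
  have key : (Complex.ofRealAm.toLinearMap ∘ₗ Algebra.trace ℝ (CyclotomicRealSpace m) :
      CyclotomicRealSpace m →ₗ[ℝ] ℂ) =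
      ∑ φ : CyclotomicField m ℚ →+* ℂ, (extendEmbedding m φ).toLinearMap := by
    apply LinearMap.ext
    intro x
    refine TensorProduct.induction_on (motive := fun z : ℝ ⊗[ℚ] CyclotomicField m ℚ =>
      (Complex.ofRealAm.toLinearMap ∘ₗ Algebra.trace ℝ (CyclotomicRealSpace m) :
      CyclotomicRealSpace m →ₗ[ℝ] ℂ) z =
      (∑ φ : CyclotomicField m ℚ →+* ℂ, (extendEmbedding m φ).toLinearMap) z) x ?_ ?_ ?_
    · exact (map_zero _).trans (map_zero (∑ φ : CyclotomicField m ℚ →+* ℂ,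
        (extendEmbedding m φ).toLinearMap)).symm
    · intro r k
      have h := trace_eq_sum_embeddings ℂ (K := ℚ) (x := k)
      have h2 : ∑ σ : CyclotomicField m ℚ →ₐ[ℚ] ℂ, σ k =
          ∑ φ : CyclotomicField m ℚ →+* ℂ, φ k :=
        (Fintype.sum_equiv (RingHom.equivRatAlgHom (CyclotomicField m ℚ) ℂ) _ _
          (fun _ => rfl)).symm
      rw [h2] at h
      refine (congrArg Complex.ofReal (trace_tmul m r k)).trans ?_
      refine Eq.trans ?_ (LinearMap.sum_apply Finset.univ
        (fun φ => (extendEmbedding m φ).toLinearMap) _).symm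
      have h3 : ∀ φ : CyclotomicField m ℚ →+* ℂ, (extendEmbedding m φ).toLinearMap
        (r ⊗ₜ[ℚ] k : ℝ ⊗[ℚ] CyclotomicField m ℚ) = r * φ k := fun φ => extendEmbedding_tmul m φ r k
      rw [Finset.sum_congr rfl (fun φ _ => h3 φ), ← Finset.mul_sum, ← h]
      simp
    · intro a b ha hb
      have h1 := map_add (Complex.ofRealAm.toLinearMap ∘ₗ Algebra.trace ℝ (CyclotomicRealSpace m) :
        CyclotomicRealSpace m →ₗ[ℝ] ℂ) a b
      have h2 := map_add (∑ φ : CyclotomicField m ℚ →+* ℂ, (extendEmbedding m φ).toLinearMap) a b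
      exact h1.trans ((congrArg₂ (· + ·) ha hb).trans h2.symm)
  simpa using LinearMap.congr_fun key x

theorem traceForm_eq_sum (x y : CyclotomicRealSpace m) :
    (traceForm m x y : ℂ) =
      ∑ φ : CyclotomicField m ℚ →+* ℂ, extendEmbedding m φ x * conj (extendEmbedding m φ y) := by
  rw [traceForm, trace_eq_sum]
  simp [extendEmbedding_conjugate]

theorem traceForm_self (x : CyclotomicRealSpace m) :
    traceForm m x x = ∑ φ : CyclotomicField m ℚ →+* ℂ, ‖extendEmbedding m φ x‖ ^ 2 := by
  have h := traceForm_eq_sum m x x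
  simp only [Complex.mul_conj'] at h
  exact_mod_cast h

theorem eq_zero_of_extendEmbedding (x : CyclotomicRealSpace m)
    (hx : ∀ φ, extendEmbedding m φ x = 0) : x = 0 := by
  let b : Module.Basis _ ℝ (CyclotomicRealSpace m) :=
    Algebra.TensorProduct.basis ℝ (integralBasis (CyclotomicField m ℚ))
  have hb : ∀ i φ, extendEmbedding m φ (b i) = φ (integralBasis (CyclotomicField m ℚ) i) := by
    intro i φ
    have h1 : b i = (1 ⊗ₜ[ℚ] integralBasis (CyclotomicField m ℚ) i :
      ℝ ⊗[ℚ] CyclotomicField m ℚ) := Algebra.TensorProduct.basis_apply _ _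
    rw [h1, extendEmbedding_tmul]
    simp
  have h0 : ∑ i, (b.repr x i : ℂ) •
      canonicalEmbedding.latticeBasis (CyclotomicField m ℚ) i = 0 := by
    funext φ
    have h := hx φ
    rw [← b.sum_repr x, map_sum] at h
    simpa [hb] using h
  have h1 := Fintype.linearIndependent_iff.1
    (canonicalEmbedding.latticeBasis (CyclotomicField m ℚ)).linearIndependent _ h0
  apply b.ext_elem
  intro i
  simpa using h1 i

/-- The trace form is a scalar product. -/
@[reducible] def innerCore : InnerProductSpace.Core ℝ (CyclotomicRealSpace m) where
  inner x y := traceForm m x y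
  conj_inner_symm x y := by
    have h : ((traceForm m y x : ℝ) : ℂ) = (traceForm m x y : ℝ) := by
      rw [← Complex.conj_ofReal (traceForm m y x), traceForm_eq_sum, traceForm_eq_sum]
      simp [mul_comm]
    simpa using! h
  re_inner_nonneg x := by
    have h := traceForm_self m x
    simp only [RCLike.re_to_real, h]
    positivity
  add_left x y z := by simp [traceForm, add_mul]
  smul_left x y r := by simp [traceForm]
  definite x hx := by
    refine eq_zero_of_extendEmbedding m x fun φ => ?_
    have h := (traceForm_self m x).symm.trans hx
    rw [Finset.sum_eq_zero_iff_of_nonneg (fun _ _ => by positivity)] at h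
    simpa using h φ (Finset.mem_univ φ)

instance : NormedAddCommGroup (CyclotomicRealSpace m) :=
  (innerCore m).toNormedAddCommGroup

instance : InnerProductSpace ℝ (CyclotomicRealSpace m) :=
  InnerProductSpace.ofCore (innerCore m).toCore

theorem inner_eq_traceForm (x y : CyclotomicRealSpace m) :
    inner ℝ x y = Algebra.trace ℝ (CyclotomicRealSpace m) (x * conjugate m y) := rfl

instance : MeasurableSpace (CyclotomicRealSpace m) := borel _

instance : BorelSpace (CyclotomicRealSpace m) := ⟨rfl⟩

end CyclotomicRealSpace

/-! ### Lattices constructed from codes -/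

/-- The Euclidean space `E = (ℚ(ζ_m) ⊗ ℝ)²`, with the scalar product
`⟨x, y⟩ = ⟨x₀, y₀⟩ + ⟨x₁, y₁⟩`. -/
abbrev CyclotomicPlane : Type := PiLp 2 (fun _ : Fin 2 => CyclotomicRealSpace m)

theorem finrank_cyclotomicPlane : Module.finrank ℝ (CyclotomicPlane m) = 2 * m.totient := by
  have h1 : Module.finrank ℝ (CyclotomicRealSpace m) = m.totient :=
    (Module.finrank_baseChange (R := ℝ) (S := ℚ) (M' := CyclotomicField m ℚ)).trans
      (IsCyclotomicExtension.finrank _ (Polynomial.cyclotomic.irreducible_rat (NeZero.pos m)))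
  rw [(WithLp.linearEquiv 2 ℝ (Fin 2 → CyclotomicRealSpace m)).finrank_eq,
    Module.finrank_pi_fintype]
  simp [h1]

variable {m}

/-- The lattice `Λ_C` of the code `C ⊆ F²`, where `F = ℤ[ζ_m] / 𝔓`: the preimage of `C` under the
coordinatewise reduction `Λ₀ = ℤ[ζ_m]² → F² = Λ₀ / 𝔓 Λ₀`, seen in `E`. -/
def codeLattice (P : Ideal (𝓞 (CyclotomicField m ℚ)))
    (C : Submodule (𝓞 (CyclotomicField m ℚ) ⧸ P) (Fin 2 → 𝓞 (CyclotomicField m ℚ) ⧸ P)) :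
    Submodule ℤ (CyclotomicPlane m) where
  carrier := {v | ∃ a : Fin 2 → 𝓞 (CyclotomicField m ℚ),
    (fun i => Ideal.Quotient.mk P (a i)) ∈ C ∧
      ∀ i, v i = CyclotomicRealSpace.of m (a i : CyclotomicField m ℚ)}
  zero_mem' := ⟨0, by simpa only [Pi.zero_apply, map_zero] using! C.zero_mem, by simp⟩
  add_mem' := by
    rintro v w ⟨a, ha, hv⟩ ⟨b, hb, hw⟩
    exact ⟨a + b, by simpa using! C.add_mem ha hb, fun i => by simp [hv, hw]⟩
  smul_mem' := by
    rintro k v ⟨a, ha, hv⟩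
    refine ⟨k • a, ?_, fun i => ?_⟩
    · have := C.toAddSubgroup.zsmul_mem ha k
      simpa using! this
    · simp [hv]

/-- The family `𝓛_𝓒` of the lattices `Λ_C`, where `C` runs through the `F`-lines of `F²`,
`F = ℤ[ζ_m] / 𝔓`. -/
def lineLatticeFamily (P : Ideal (𝓞 (CyclotomicField m ℚ))) :
    Set (Submodule ℤ (CyclotomicPlane m)) :=
  {L | ∃ C : Submodule (𝓞 (CyclotomicField m ℚ) ⧸ P) (Fin 2 → 𝓞 (CyclotomicField m ℚ) ⧸ P),
    Module.finrank (𝓞 (CyclotomicField m ℚ) ⧸ P) C = 1 ∧ L = codeLattice P C}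

/-- `𝔓` is a prime ideal of `ℤ[ζ_m]` lying over a prime number that does not divide `m`. -/
def IsPrimeAwayFromConductor (P : Ideal (𝓞 (CyclotomicField m ℚ))) : Prop :=
  P.IsPrime ∧ ∃ p : ℕ, p.Prime ∧ ¬ p ∣ m ∧ (p : 𝓞 (CyclotomicField m ℚ)) ∈ P

/-- The family `𝓛_𝓒` attached to `𝔓` contains a lattice of density at least
`0.89 * n * log log n / 2 ^ n`, where `n = 2 φ(m)`. -/
def HasDenseLineLattice (P : Ideal (𝓞 (CyclotomicField m ℚ))) : Prop :=
  ∃ L ∈ lineLatticeFamily P, IsEuclideanLattice L ∧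
    0.89 * ((2 * m.totient : ℕ) : ℝ) * Real.log (Real.log ((2 * m.totient : ℕ) : ℝ)) /
      2 ^ (2 * m.totient) ≤ latticeDensity L

end Cyclotomic

/-! ### Choices of prime ideals along the primorials -/

instance primorial_neZero (X : ℕ) : NeZero (primorial X) := ⟨(primorial_pos X).ne'⟩

/-- A choice, for each `X`, of a prime ideal of `ℤ[ζ_m]`, `m` the product of the primes at most
`X`, that lies over a prime number not dividing `m`, where the cardinalities `q` of the residue
fields satisfy `φ(m)² m = o(q ^ (1 / φ(m)))` as `X → ∞`. -/
def IsAdmissibleChoice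
    (P : ∀ X : ℕ, Ideal (𝓞 (CyclotomicField (primorial X) ℚ))) : Prop :=
  (∀ X, IsPrimeAwayFromConductor (P X)) ∧
  (fun X : ℕ => ((primorial X).totient : ℝ) ^ 2 * (primorial X : ℝ)) =o[atTop]
    (fun X : ℕ => (Nat.card (𝓞 (CyclotomicField (primorial X) ℚ) ⧸ P X) : ℝ) ^
      (1 / ((primorial X).totient : ℝ)))

end

/-- The logarithm `-log (1 - 1 / p)` of an Euler factor of the zeta function at `1`. -/
noncomputable def eulerFactorLog (p : ℕ) : ℝ := -Real.log (1 - 1 / (p : ℝ))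

/-- The logarithm of the product of the Euler factors at `1` of the primes up to `n`. -/
noncomputable def eulerProductLog (n : ℕ) : ℝ := ∑ p ∈ Nat.primesLE n, eulerFactorLog p

theorem one_div_le_eulerFactorLog {p : ℕ} (hp : 2 ≤ p) : 1 / (p : ℝ) ≤ eulerFactorLog p := by
  have h2 : (2 : ℝ) ≤ p := by exact_mod_cast hp
  have h : 0 < 1 - 1 / (p : ℝ) := by
    rw [sub_pos, div_lt_one (by linarith)]; linarith
  have := Real.log_le_sub_one_of_pos h
  unfold eulerFactorLog
  linarith

theorem eulerFactorLog_le {p : ℕ} (hp : 2 ≤ p) : eulerFactorLog p ≤ 1 / ((p : ℝ) - 1) := by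
  have h2 : (2 : ℝ) ≤ p := by exact_mod_cast hp
  have h : 0 < 1 - 1 / (p : ℝ) := by
    rw [sub_pos, div_lt_one (by linarith)]; linarith
  have := Real.log_le_sub_one_of_pos (inv_pos.2 h)
  rw [Real.log_inv] at this
  unfold eulerFactorLog
  refine this.trans (le_of_eq ?_)
  have : (p : ℝ) - 1 ≠ 0 := by linarith
  have : (p : ℝ) ≠ 0 := by linarith
  field_simp
  ring

theorem eulerFactorLog_nonneg {p : ℕ} (hp : 2 ≤ p) : 0 ≤ eulerFactorLog p :=
  le_trans (by positivity) (one_div_le_eulerFactorLog hp)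

theorem eulerProductLog_mono : Monotone eulerProductLog := fun _ _ h =>
  Finset.sum_le_sum_of_subset_of_nonneg (Nat.primesLE_mono h) fun _ hp _ =>
    eulerFactorLog_nonneg (Nat.two_le_of_mem_primesLE hp)

theorem factorization_factorial_le {p n : ℕ} (hp : p.Prime) :
    ((n.factorial.factorization p : ℕ) : ℝ) ≤ n / ((p : ℝ) - 1) := by
  have h2 : (2 : ℝ) ≤ p := by exact_mod_cast hp.two_le
  rw [le_div_iff₀ (by linarith), mul_comm]
  have h := Nat.sub_one_mul_factorization_factorial (n := n) hp
  have h3 : (p - 1) * n.factorial.factorization p ≤ n := by omega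
  have h4 : (((p - 1) * n.factorial.factorization p : ℕ) : ℝ) ≤ n := by exact_mod_cast h3
  rwa [Nat.cast_mul, Nat.cast_sub hp.one_le, Nat.cast_one] at h4

theorem le_factorization_factorial {p n : ℕ} (hp : p.Prime) :
    (n : ℝ) / p - 1 ≤ ((n.factorial.factorization p : ℕ) : ℝ) := by
  have h1 : n / p ≤ n.factorial.factorization p := by
    have h := Nat.factorization_factorial_mul (n := n / p) hp
    have h2 := (Nat.factorization_le_iff_dvd (Nat.factorial_ne_zero _)
      (Nat.factorial_ne_zero _)).2 (Nat.factorial_dvd_factorial (Nat.mul_div_le n p)) p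
    omega
  have h2 : ((n / p : ℕ) : ℝ) ≤ (n.factorial.factorization p : ℕ) := by exact_mod_cast h1
  have h3 := Nat.lt_floor_add_one ((n : ℝ) / p)
  rw [Nat.floor_div_eq_div] at h3
  linarith

theorem log_factorial_eq_sum (n : ℕ) : Real.log n.factorial =
    ∑ p ∈ Nat.primesLE n, ((n.factorial.factorization p : ℕ) : ℝ) * Real.log p := by
  have h : (n.factorial : ℝ) = ∏ p ∈ Nat.primesLE n, (p : ℝ) ^ n.factorial.factorization p := by
    have h1 := Nat.prod_factorization_pow_eq_self n.factorial_ne_zero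
    rw [Finsupp.prod_of_support_subset (s := Nat.primesLE n) _ ?_ _ (by simp)] at h1
    · nth_rw 1 [← h1]
      push_cast
      rfl
    · intro p hp
      rw [Nat.support_factorization, Nat.mem_primeFactors] at hp
      rw [Nat.mem_primesLE]
      exact ⟨(hp.1.dvd_factorial).1 hp.2.1, hp.1⟩
  rw [h, Real.log_prod]
  · simp
  · intro p hp
    have := (Nat.prime_of_mem_primesLE hp).pos
    positivity

theorem exists_sum_log_div_le : ∃ C : ℝ, 0 ≤ C ∧ ∀ n : ℕ,
    ∑ p ∈ Nat.primesLE n, (Real.log p / ((p : ℝ) - 1) - Real.log p / p) ≤ C := by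
  have hs : Summable fun n : ℕ => 4 * (n : ℝ) ^ (-(3 / 2) : ℝ) :=
    (Real.summable_nat_rpow.2 (by norm_num)).mul_left _
  refine ⟨_, tsum_nonneg (fun n => by positivity), fun n =>
    (Finset.sum_le_sum fun p hp => ?_).trans (hs.sum_le_tsum (Nat.primesLE n) fun n _ => by positivity)⟩
  have h2 : (2 : ℝ) ≤ p := by exact_mod_cast Nat.two_le_of_mem_primesLE hp
  have hl : Real.log p ≤ 2 * (p : ℝ) ^ (1 / 2 : ℝ) := by
    have := Real.log_le_rpow_div (x := (p : ℝ)) (by linarith) (ε := 1 / 2) (by norm_num)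
    linarith
  have he : Real.log p / ((p : ℝ) - 1) - Real.log p / p = Real.log p / (p * (p - 1)) := by
    have : (p : ℝ) - 1 ≠ 0 := by linarith
    have : (p : ℝ) ≠ 0 := by linarith
    field_simp
    ring
  rw [he, div_le_iff₀ (by nlinarith)]
  have h4 : (p : ℝ) ^ (1 / 2 : ℝ) = (p : ℝ) ^ (-(3 / 2) : ℝ) * (p : ℝ) ^ 2 := by
    rw [← Real.rpow_natCast, ← Real.rpow_add (by linarith)]
    norm_num
  rw [h4] at hl
  refine hl.trans ?_
  have h5 : 0 ≤ (p : ℝ) ^ (-(3 / 2) : ℝ) := by positivity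
  nlinarith [mul_nonneg h5 (by nlinarith : (0 : ℝ) ≤ p * (p - 2))]

/-- A two-sided form of Mertens' first theorem. -/
theorem exists_abs_sum_log_mul_eulerFactorLog_sub_log_le : ∃ C : ℝ, ∀ n : ℕ, 1 ≤ n →
    |∑ p ∈ Nat.primesLE n, Real.log p * eulerFactorLog p - Real.log n| ≤ C := by
  obtain ⟨C, hC, h⟩ := exists_sum_log_div_le
  refine ⟨C + 2, fun n hn => ?_⟩
  have hn0 : (0 : ℝ) < n := by exact_mod_cast hn
  have hlog (p) (hp : p ∈ Nat.primesLE n) : 0 ≤ Real.log p := Real.log_natCast_nonneg p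
  have h2 (p) (hp : p ∈ Nat.primesLE n) : (2 : ℝ) ≤ p := by
    exact_mod_cast Nat.two_le_of_mem_primesLE hp
  have hA : ∑ p ∈ Nat.primesLE n, Real.log p * eulerFactorLog p ≤
      ∑ p ∈ Nat.primesLE n, Real.log p / ((p : ℝ) - 1) := Finset.sum_le_sum fun p hp => by
    rw [div_eq_mul_one_div]
    exact mul_le_mul_of_nonneg_left (eulerFactorLog_le (Nat.two_le_of_mem_primesLE hp)) (hlog p hp)
  have hB : ∑ p ∈ Nat.primesLE n, Real.log p / (p : ℝ) ≤
      ∑ p ∈ Nat.primesLE n, Real.log p * eulerFactorLog p := Finset.sum_le_sum fun p hp => by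
    rw [div_eq_mul_one_div]
    exact mul_le_mul_of_nonneg_left
      (one_div_le_eulerFactorLog (Nat.two_le_of_mem_primesLE hp)) (hlog p hp)
  have hf1 : Real.log n.factorial ≤ n * ∑ p ∈ Nat.primesLE n, Real.log p / ((p : ℝ) - 1) := by
    rw [log_factorial_eq_sum, Finset.mul_sum]
    refine Finset.sum_le_sum fun p hp => ?_
    have := mul_le_mul_of_nonneg_right
      (factorization_factorial_le (n := n) (Nat.prime_of_mem_primesLE hp)) (hlog p hp)
    refine this.trans (le_of_eq ?_)
    ring
  have hf2 : n * ∑ p ∈ Nat.primesLE n, Real.log p / (p : ℝ) - Chebyshev.theta n ≤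
      Real.log n.factorial := by
    rw [log_factorial_eq_sum, Finset.mul_sum, Chebyshev.theta_eq_sum_primesLE_log,
      ← Finset.sum_sub_distrib]
    refine Finset.sum_le_sum fun p hp => ?_
    have := mul_le_mul_of_nonneg_right
      (le_factorization_factorial (n := n) (Nat.prime_of_mem_primesLE hp)) (hlog p hp)
    refine (le_of_eq ?_).trans this
    ring
  have hθ := Chebyshev.theta_le_log4_mul_x hn0.le
  have h4 : Real.log 4 ≤ 2 := by
    rw [show (4 : ℝ) = 2 ^ 2 by norm_num, Real.log_pow]
    have := Real.log_two_lt_d9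
    norm_num; linarith
  have hu : Real.log n.factorial ≤ n * Real.log n := by
    rw [← Real.log_pow]
    exact Real.log_le_log (by exact_mod_cast n.factorial_pos) (by exact_mod_cast n.factorial_le_pow)
  have hl : n * Real.log n - n ≤ Real.log n.factorial := by
    have h1 := Stirling.le_log_factorial_stirling (n := n) (by omega)
    have h3 := Real.log_natCast_nonneg n
    have h5 : 0 ≤ Real.log (2 * Real.pi) := Real.log_nonneg (by linarith [Real.pi_gt_three])
    linarith
  have hd := h n
  rw [Finset.sum_sub_distrib] at hd
  have e1 : Real.log n - 1 ≤ ∑ p ∈ Nat.primesLE n, Real.log p / ((p : ℝ) - 1) := by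
    refine le_of_mul_le_mul_left (a := (n : ℝ)) ?_ hn0
    linarith
  have e2 : ∑ p ∈ Nat.primesLE n, Real.log p / (p : ℝ) ≤ Real.log n + 2 := by
    refine le_of_mul_le_mul_left (a := (n : ℝ)) ?_ hn0
    nlinarith
  rw [abs_le]
  constructor <;> linarith

theorem exists_eulerProductLog_sub_le : ∃ C : ℝ, 0 ≤ C ∧ ∀ x y : ℕ, 2 ≤ x → x ≤ y →
    eulerProductLog y - eulerProductLog x ≤
      Real.log (Real.log y) - Real.log (Real.log x) + C / Real.log x := by
  obtain ⟨C, hC⟩ := exists_abs_sum_log_mul_eulerFactorLog_sub_log_le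
  have hC0 : 0 ≤ C := (abs_nonneg _).trans (hC 1 le_rfl)
  set E : ℕ → ℝ := fun n => ∑ p ∈ Nat.primesLE n, Real.log p * eulerFactorLog p - Real.log n
    with hE
  have hlog {n : ℕ} (hn : 2 ≤ n) : 0 < Real.log n := Real.log_pos (by exact_mod_cast hn)
  refine ⟨2 * C, by positivity, fun x y hx hxy => ?_⟩
  have key : eulerProductLog y - eulerProductLog x ≤ Real.log (Real.log y) - Real.log (Real.log x) +
      E y / Real.log y - E x / Real.log x + C * (1 / Real.log x - 1 / Real.log y) := by
    induction y, hxy using Nat.le_induction with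
    | base => simp
    | succ n hxn ih =>
      have hL := hlog (hx.trans hxn)
      have hL' := hlog (n := n + 1) (by omega)
      have hLL : Real.log n ≤ Real.log (n + 1 : ℕ) :=
        Real.log_le_log (by exact_mod_cast (by omega : 0 < n)) (by push_cast; linarith)
      have hstep : eulerProductLog (n + 1) - eulerProductLog n =
          (Real.log (n + 1 : ℕ) - Real.log n + E (n + 1) - E n) / Real.log (n + 1 : ℕ) := by
        rw [eq_div_iff hL'.ne']
        simp only [eulerProductLog, hE, Nat.primesLE_succ]
        split_ifs
        · rw [Finset.sum_insert (Nat.notMem_primesLE n), Finset.sum_insert (Nat.notMem_primesLE n)]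
          ring
        · ring
      have h1 : 1 - Real.log n / Real.log (n + 1 : ℕ) ≤
          Real.log (Real.log (n + 1 : ℕ)) - Real.log (Real.log n) := by
        have := Real.log_le_sub_one_of_pos (div_pos hL hL')
        rw [Real.log_div hL.ne' hL'.ne'] at this
        linarith
      have h2 : E n * (1 / Real.log n - 1 / Real.log (n + 1 : ℕ)) ≤
          C * (1 / Real.log n - 1 / Real.log (n + 1 : ℕ)) := by
        refine mul_le_mul_of_nonneg_right ((le_abs_self _).trans (hC n (by omega))) ?_
        rw [sub_nonneg]
        exact one_div_le_one_div_of_le hL hLL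
      have h3 : (Real.log (n + 1 : ℕ) - Real.log n + E (n + 1) - E n) / Real.log (n + 1 : ℕ) =
          1 - Real.log n / Real.log (n + 1 : ℕ) + E (n + 1) / Real.log (n + 1 : ℕ)
            - E n * (1 / Real.log (n + 1 : ℕ)) := by
        field_simp
      have h4 : E n * (1 / Real.log n) = E n / Real.log n := by ring
      rw [h3] at hstep
      linarith
  have hLx := hlog hx
  have hLy := hlog (hx.trans hxy)
  have h1 : E y / Real.log y ≤ C / Real.log y :=
    div_le_div_of_nonneg_right ((le_abs_self _).trans (hC y (by omega))) hLy.le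
  have h2 : -E x / Real.log x ≤ C / Real.log x :=
    div_le_div_of_nonneg_right ((neg_le_abs _).trans (hC x (by omega))) hLx.le
  have h3 : 2 * C / Real.log x = C / Real.log x + C / Real.log x := by ring
  have h4 : C * (1 / Real.log x - 1 / Real.log y) = C / Real.log x - C / Real.log y := by ring
  rw [neg_div] at h2
  linarith

theorem one_div_le_tsum_rpow {s : ℝ} (hs : 0 < s) : 1 / s ≤ ∑' n : ℕ, (n : ℝ) ^ (-(1 + s)) := by
  have hsum : Summable fun n : ℕ => (n : ℝ) ^ (-(1 + s)) :=
    Real.summable_nat_rpow.2 (by linarith)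
  have h := AntitoneOn.integral_le_tsum_comp_add (f := fun t : ℝ => t ^ (-(1 + s))) 1 ?_ hsum ?_
  · rw [Nat.cast_one, integral_Ioi_rpow_of_lt (by linarith) one_pos, Real.one_rpow] at h
    have h2 := hsum.sum_add_tsum_nat_add 1
    have h3 : (0 : ℝ) ≤ ∑ i ∈ Finset.range 1, (i : ℝ) ^ (-(1 + s)) :=
      Finset.sum_nonneg fun i _ => by positivity
    have h4 : -1 / (-(1 + s) + 1) = 1 / s := by
      rw [show -(1 + s) + 1 = -s by ring, neg_div_neg_eq]
    linarith
  · intro a ha b _ hab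
    have ha1 : (1 : ℝ) ≤ a := by simpa using ha
    exact Real.rpow_le_rpow_of_nonpos (by linarith) hab (by linarith)
  · intro t ht
    have ht1 : (1 : ℝ) < t := by simpa using ht
    positivity

theorem inv_one_sub_rpow_le_exp {p : ℕ} (hp : 2 ≤ p) {s : ℝ} (hs : 0 < s) :
    (1 - (p : ℝ) ^ (-(1 + s)))⁻¹ ≤ Real.exp (eulerFactorLog p * (p : ℝ) ^ (-s)) := by
  have h2 : (2 : ℝ) ≤ p := by exact_mod_cast hp
  have h0 : (0 : ℝ) < p := by linarith
  have h : 0 < 1 - 1 / (p : ℝ) := by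
    rw [sub_pos, div_lt_one h0]; linarith
  have ht0 : 0 < (p : ℝ) ^ (-s) := by positivity
  have ht1 : (p : ℝ) ^ (-s) ≤ 1 := Real.rpow_le_one_of_one_le_of_nonpos (by linarith) (by linarith)
  have hb := rpow_one_add_le_one_add_mul_self (s := -(1 / (p : ℝ))) (by linarith) ht0.le ht1
  have he : (1 + -(1 / (p : ℝ))) ^ ((p : ℝ) ^ (-s)) =
      (Real.exp (eulerFactorLog p * (p : ℝ) ^ (-s)))⁻¹ := by
    rw [← sub_eq_add_neg, Real.rpow_def_of_pos h, ← Real.exp_neg, eulerFactorLog, neg_mul, neg_neg]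
  have hr : (p : ℝ) ^ (-(1 + s)) = (p : ℝ) ^ (-s) * (1 / p) := by
    rw [show -(1 + s) = -s + -1 by ring, Real.rpow_add h0, Real.rpow_neg_one, one_div]
  rw [he] at hb
  refine inv_le_of_inv_le₀ (Real.exp_pos _) (hb.trans (le_of_eq ?_))
  rw [hr]
  ring

theorem log_one_div_le_of_forall_finset {s b : ℝ} (hs : 0 < s)
    (h : ∀ S : Finset Nat.Primes, ∑ p ∈ S, eulerFactorLog p * ((p : ℕ) : ℝ) ^ (-s) ≤ b) :
    Real.log (1 / s) ≤ b := by
  let f : ℕ →*₀ ℝ :=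
    { toFun n := (n : ℝ) ^ (-(1 + s))
      map_zero' := by
        rw [Nat.cast_zero, Real.zero_rpow (by linarith)]
      map_one' := by simp
      map_mul' m n := by
        rw [Nat.cast_mul, Real.mul_rpow (Nat.cast_nonneg _) (Nat.cast_nonneg _)] }
  have hsum : Summable fun n : ℕ => (n : ℝ) ^ (-(1 + s)) :=
    Real.summable_nat_rpow.2 (by linarith)
  have hprod := EulerProduct.eulerProduct_completely_multiplicative_hasProd (f := f) hsum.norm
  have hle : ∑' n, f n ≤ Real.exp b := by
    refine le_of_tendsto' hprod fun S => ?_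
    refine (Finset.prod_le_prod (fun p _ => ?_) fun p _ =>
      inv_one_sub_rpow_le_exp p.2.two_le hs).trans ?_
    · rw [inv_nonneg, sub_nonneg]
      exact Real.rpow_le_one_of_one_le_of_nonpos (by exact_mod_cast p.2.one_le) (by linarith)
    · rw [← Real.exp_sum]
      exact Real.exp_le_exp.2 (h S)
  rw [Real.log_le_iff_le_exp (by positivity)]
  exact (one_div_le_tsum_rpow hs).trans hle

theorem hasSum_ite_le_pow {z : ℝ} (h0 : 0 ≤ z) (h1 : z < 1) (k : ℕ) :
    HasSum (fun j => if k ≤ j then z ^ j else 0) (z ^ k * (1 - z)⁻¹) := by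
  have h := (hasSum_geometric_of_lt_one h0 h1).mul_left (z ^ k)
  have hi : Function.Injective (fun j : ℕ => j + k) := add_left_injective k
  rw [← hi.hasSum_iff]
  · convert! h using 2 with j
    simp [pow_add, mul_comm]
  · intro j hj
    rw [if_neg]
    intro hkj
    exact hj ⟨j - k, by simp [hkj]⟩

theorem log_one_div_le_of_eulerProductLog_le {s : ℝ} (hs : 0 < s) {B : ℕ → ℝ} {V : ℝ}
    (hB : ∀ j : ℕ, eulerProductLog ⌊Real.exp (j + 1)⌋₊ ≤ B j)
    (hV : HasSum (fun j => Real.exp (-s) ^ j * B j) V) :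
    Real.log (1 / s) ≤ (1 - Real.exp (-s)) * V := by
  set z := Real.exp (-s) with hz
  have hz0 : 0 < z := Real.exp_pos _
  have hz1 : z < 1 := Real.exp_lt_one_iff.2 (by linarith)
  refine log_one_div_le_of_forall_finset hs fun S => ?_
  have hp (p : Nat.Primes) : ((p : ℕ) : ℝ) ^ (-s) ≤ z ^ ⌊Real.log (p : ℕ)⌋₊ := by
    rw [Real.rpow_def_of_pos (by exact_mod_cast p.2.pos), hz, ← Real.exp_nat_mul]
    refine Real.exp_le_exp.2 ?_
    have := Nat.floor_le (Real.log_natCast_nonneg (p : ℕ))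
    nlinarith
  have hk (p : Nat.Primes) := hasSum_ite_le_pow hz0.le hz1 ⌊Real.log (p : ℕ)⌋₊
  have hS := hasSum_sum (s := S) fun p _ => (hk p).mul_left (eulerFactorLog p)
  have hle := hasSum_le (fun j => ?_) hS hV
  · calc _ ≤ ∑ p ∈ S, eulerFactorLog p * z ^ ⌊Real.log (p : ℕ)⌋₊ :=
        Finset.sum_le_sum fun p _ =>
          mul_le_mul_of_nonneg_left (hp p) (eulerFactorLog_nonneg p.2.two_le)
      _ = (1 - z) * ∑ p ∈ S, eulerFactorLog p * (z ^ ⌊Real.log (p : ℕ)⌋₊ * (1 - z)⁻¹) := by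
        rw [Finset.mul_sum]
        refine Finset.sum_congr rfl fun p _ => ?_
        have : 1 - z ≠ 0 := by linarith
        field_simp
      _ ≤ _ := mul_le_mul_of_nonneg_left hle (by linarith)
  · calc _ = z ^ j * ∑ p ∈ S with ⌊Real.log (p : Nat.Primes)⌋₊ ≤ j, eulerFactorLog p := by
          rw [Finset.sum_filter, Finset.mul_sum]
          refine Finset.sum_congr rfl fun p _ => ?_
          split_ifs <;> ring
      _ ≤ z ^ j * eulerProductLog ⌊Real.exp (j + 1)⌋₊ := by
          refine mul_le_mul_of_nonneg_left ?_ (by positivity)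
          refine (Finset.sum_map (S.filter _) ⟨_, Nat.Primes.coe_nat_injective⟩
            eulerFactorLog).symm.trans_le ?_
          refine Finset.sum_le_sum_of_subset_of_nonneg ?_ fun p hp _ =>
            eulerFactorLog_nonneg (Nat.two_le_of_mem_primesLE hp)
          intro p hp
          simp only [Finset.mem_map, Finset.mem_filter] at hp
          obtain ⟨q, ⟨_, hq⟩, rfl⟩ := hp
          rw [Nat.mem_primesLE]
          refine ⟨Nat.le_floor ?_, q.2⟩
          rw [← Real.log_le_iff_le_exp (by exact_mod_cast q.2.pos)]
          have h1 := Nat.lt_floor_add_one (Real.log (q : ℕ))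
          have h2 : ((⌊Real.log (q : ℕ)⌋₊ : ℕ) : ℝ) ≤ j := by exact_mod_cast hq
          exact h1.le.trans (by linarith)
      _ ≤ _ := mul_le_mul_of_nonneg_left (hB j) (by positivity)

theorem hasSum_pow_mul_harmonic {z : ℝ} (h0 : 0 < z) (h1 : z < 1) :
    HasSum (fun j : ℕ => z ^ j * (harmonic (j + 1) : ℝ))
      (-Real.log (1 - z) / z * (1 - z)⁻¹) := by
  have hl : HasSum (fun n : ℕ => z ^ n / (n + 1)) (-Real.log (1 - z) / z) := by
    have h := (Real.hasSum_pow_div_log_of_abs_lt_one (x := z) (by rwa [abs_of_pos h0])).div_const z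
    refine h.congr_fun fun n => ?_
    rw [pow_succ]
    field_simp
  have hg := hasSum_geometric_of_lt_one h0.le h1
  have h := hasSum_sum_range_mul_of_summable_norm hl.summable.norm hg.summable.norm
  rw [hl.tsum_eq, hg.tsum_eq] at h
  convert! h using 2 with j
  rw [harmonic]
  push_cast
  rw [Finset.mul_sum]
  refine Finset.sum_congr rfl fun k hk => ?_
  have hkj : k ≤ j := by simpa [Nat.lt_succ_iff] using hk
  rw [div_mul_eq_mul_div, ← pow_add, Nat.add_sub_cancel' hkj, div_eq_mul_inv]

theorem tendsto_log_add_exp_mul_log :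
    Tendsto (fun s : ℝ => Real.log s - Real.log (1 - Real.exp (-s)) / Real.exp (-s))
      (𝓝[>] 0) (𝓝 0) := by
  have hu : Tendsto (fun s : ℝ => 1 - Real.exp (-s)) (𝓝[>] 0) (𝓝 0) := by
    have : Continuous fun s : ℝ => 1 - Real.exp (-s) := by fun_prop
    simpa using (this.tendsto 0).mono_left nhdsWithin_le_nhds
  have h1 : Tendsto (fun s : ℝ => (1 - Real.exp (-s)) * Real.log (1 - Real.exp (-s)))
      (𝓝[>] 0) (𝓝 0) := by
    simpa [Function.comp_def] using (Real.continuous_mul_log.tendsto 0).comp hu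
  have h2 : Tendsto (fun s : ℝ => Real.exp s) (𝓝[>] 0) (𝓝 1) := by
    simpa using (Real.continuous_exp.tendsto 0).mono_left nhdsWithin_le_nhds
  have h3 : Tendsto (fun s : ℝ => (1 - Real.exp (-s)) / s) (𝓝[>] 0) (𝓝 1) := by
    have hd : HasDerivAt (fun s : ℝ => 1 - Real.exp (-s)) 1 0 := by
      have := ((hasDerivAt_id (0 : ℝ)).neg.exp).const_sub 1
      simpa using! this
    have := hd.tendsto_slope_zero_right
    simpa [div_eq_inv_mul] using this
  have h4 := ((Real.continuousAt_log one_ne_zero).tendsto.comp h3)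
  rw [Real.log_one] at h4
  have h5 := (h4.add (h2.mul h1)).neg
  simp only [mul_zero, add_zero, neg_zero] at h5
  refine h5.congr' ?_
  filter_upwards [self_mem_nhdsWithin] with s hs
  have hs : 0 < s := hs
  have hpos : 0 < 1 - Real.exp (-s) := by
    have := Real.exp_lt_one_iff.2 (by linarith : -s < 0)
    linarith
  simp only [Function.comp_apply]
  rw [Real.log_div hpos.ne' hs.ne', ← mul_assoc, mul_sub, ← Real.exp_add, add_neg_cancel,
    Real.exp_zero, div_eq_mul_inv, ← Real.exp_neg, neg_neg]
  ring

theorem eventually_le_eulerProductLog {δ : ℝ} (hδ : 0 < δ) : ∀ᶠ X : ℕ in atTop,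
    Real.log (Real.log X) + Real.eulerMascheroniConstant - δ ≤ eulerProductLog X := by
  obtain ⟨C, hC, hinc⟩ := exists_eulerProductLog_sub_le
  have hlim : Tendsto (fun X : ℕ => C / Real.log X) atTop (𝓝 0) :=
    (Real.tendsto_log_atTop.comp tendsto_natCast_atTop_atTop).const_div_atTop C
  filter_upwards [eventually_ge_atTop 2, hlim.eventually_lt_const (half_pos hδ)] with x hx hCx
  by_contra! hbad
  have hbound : ∀ y : ℕ, x ≤ y → eulerProductLog y ≤
      Real.log (Real.log y) + Real.eulerMascheroniConstant - δ / 2 := fun y hy => by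
    have := hinc x y hx hy
    linarith
  have hB : ∀ j : ℕ, eulerProductLog ⌊Real.exp (j + 1)⌋₊ ≤ (harmonic (j + 1) : ℝ) - δ / 2 +
      if j < x then eulerProductLog ⌊Real.exp (x + 1)⌋₊ + δ / 2 else 0 := fun j => by
    split_ifs with hj
    · have h1 : (0 : ℝ) ≤ (harmonic (j + 1) : ℝ) := by
        exact_mod_cast (harmonic_pos (Nat.succ_ne_zero j)).le
      have h2 : eulerProductLog ⌊Real.exp (j + 1)⌋₊ ≤ eulerProductLog ⌊Real.exp (x + 1)⌋₊ :=
        eulerProductLog_mono (Nat.floor_mono (Real.exp_le_exp.2 (by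
          have : (j : ℝ) < x := by exact_mod_cast hj
          linarith)))
      linarith
    · push Not at hj
      have hfl : x ≤ ⌊Real.exp (j + 1)⌋₊ := Nat.le_floor (by
        have h1 : (x : ℝ) ≤ j := by exact_mod_cast hj
        have h2 := Real.add_one_le_exp ((j : ℝ) + 1)
        linarith)
      have hx0 : (2 : ℝ) ≤ ⌊Real.exp (j + 1)⌋₊ := by exact_mod_cast hx.trans hfl
      have h1 : Real.log ⌊Real.exp ((j : ℝ) + 1)⌋₊ ≤ j + 1 := by
        rw [Real.log_le_iff_le_exp (by linarith)]
        exact Nat.floor_le (Real.exp_pos _).le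
      have h2 := Real.log_le_log (Real.log_pos (by linarith)) h1
      have h3 := Real.eulerMascheroniConstant_lt_eulerMascheroniSeq' (j + 1)
      simp only [Real.eulerMascheroniSeq', Nat.succ_ne_zero, if_false] at h3
      push_cast at h3
      have := hbound _ hfl
      linarith
  set D := eulerProductLog ⌊Real.exp (x + 1)⌋₊ + δ / 2
  have key : ∀ s : ℝ, 0 < s → 0 ≤ (Real.log s - Real.log (1 - Real.exp (-s)) / Real.exp (-s))
      - δ / 2 + (1 - Real.exp (-s)) * ∑ j ∈ Finset.range x, Real.exp (-s) ^ j * D := fun s hs => by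
    have hz0 : 0 < Real.exp (-s) := Real.exp_pos _
    have hz1 : Real.exp (-s) < 1 := Real.exp_lt_one_iff.2 (by linarith)
    have hV1 := hasSum_pow_mul_harmonic hz0 hz1
    have hV2 := (hasSum_geometric_of_lt_one hz0.le hz1).mul_right (δ / 2)
    have hV3 : HasSum (fun j => Real.exp (-s) ^ j * if j < x then D else 0)
        (∑ j ∈ Finset.range x, Real.exp (-s) ^ j * D) := by
      have : HasSum (fun j => Real.exp (-s) ^ j * if j < x then D else 0) _ :=
        hasSum_sum_of_ne_finset_zero (s := Finset.range x) fun j hj => by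
          rw [if_neg (by simpa using hj), mul_zero]
      convert! this using 1
      refine Finset.sum_congr rfl fun j hj => ?_
      rw [if_pos (by simpa using hj)]
    have h := log_one_div_le_of_eulerProductLog_le hs hB
      (V := -Real.log (1 - Real.exp (-s)) / Real.exp (-s) * (1 - Real.exp (-s))⁻¹ -
        (1 - Real.exp (-s))⁻¹ * (δ / 2) + ∑ j ∈ Finset.range x, Real.exp (-s) ^ j * D)
      (((hV1.sub hV2).add hV3).congr_fun fun j => by ring)
    have hne : 1 - Real.exp (-s) ≠ 0 := by linarith
    have e : (1 - Real.exp (-s)) *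
        (-Real.log (1 - Real.exp (-s)) / Real.exp (-s) * (1 - Real.exp (-s))⁻¹ -
        (1 - Real.exp (-s))⁻¹ * (δ / 2) + ∑ j ∈ Finset.range x, Real.exp (-s) ^ j * D) =
        -(Real.log (1 - Real.exp (-s)) / Real.exp (-s)) - δ / 2 +
        (1 - Real.exp (-s)) * ∑ j ∈ Finset.range x, Real.exp (-s) ^ j * D := by
      generalize ∑ j ∈ Finset.range x, Real.exp (-s) ^ j * D = W
      field_simp
    rw [e, one_div, Real.log_inv] at h
    linarith
  have ht : Tendsto (fun s : ℝ => (Real.log s - Real.log (1 - Real.exp (-s)) / Real.exp (-s))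
      - δ / 2 + (1 - Real.exp (-s)) * ∑ j ∈ Finset.range x, Real.exp (-s) ^ j * D)
      (𝓝[>] 0) (𝓝 (0 - δ / 2 + 0)) := by
    refine (tendsto_log_add_exp_mul_log.sub_const _).add ?_
    have : Continuous fun s : ℝ => (1 - Real.exp (-s)) *
        ∑ j ∈ Finset.range x, Real.exp (-s) ^ j * D := by fun_prop
    simpa using (this.tendsto 0).mono_left nhdsWithin_le_nhds
  have := ge_of_tendsto ht (by filter_upwards [self_mem_nhdsWithin] with s hs using key s hs)
  linarith

theorem harmonic_sub_log_sub_le_eulerMascheroniConstant {n : ℕ} (hn : 1 ≤ n) :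
    (harmonic n : ℝ) - Real.log n - 1 / (2 * n) ≤ Real.eulerMascheroniConstant := by
  set u : ℕ → ℝ := fun n => (harmonic n : ℝ) - Real.log n - 1 / (2 * n) with hu
  have hmono : ∀ k, n ≤ k → u k ≤ u (k + 1) := fun k hk => by
    have hk0 : (0 : ℝ) < k := by exact_mod_cast (by omega : 0 < k)
    have h : Real.log ((k + 1) / k) ≤ (1 / 2) * (1 / (k : ℝ) + 1 / (k + 1)) := by
      have hw : 1 ≤ ((k : ℝ) + 1) / k := by
        rw [le_div_iff₀ hk0]
        linarith
      have h1 := Real.self_le_sinh_iff.2 (Real.log_nonneg hw)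
      rw [Real.sinh_log (by positivity)] at h1
      refine h1.trans (le_of_eq ?_)
      field_simp
      ring
    rw [Real.log_div (by positivity) (by positivity)] at h
    simp only [hu, harmonic_succ]
    push_cast
    have e1 : 1 / (2 * (k : ℝ)) = (1 / 2) * (1 / (k : ℝ)) := by field_simp
    have e2 : 1 / (2 * ((k : ℝ) + 1)) = (1 / 2) * (1 / ((k : ℝ) + 1)) := by field_simp
    rw [e1, e2, ← one_div]
    linarith
  have hle : ∀ k, n ≤ k → u n ≤ u k := fun k hk => by
    induction k, hk using Nat.le_induction with
    | base => exact le_rfl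
    | succ k hk ih => exact ih.trans (hmono k hk)
  refine ge_of_tendsto Real.tendsto_harmonic_sub_log ?_
  filter_upwards [eventually_ge_atTop n] with k hk
  have := hle k hk
  have h0 : (0 : ℝ) ≤ 1 / (2 * k) := by positivity
  simp only [hu] at this
  linarith

theorem lt_exp_eulerMascheroniConstant :
    (1.7805 : ℝ) < Real.exp Real.eulerMascheroniConstant := by
  have h := harmonic_sub_log_sub_le_eulerMascheroniConstant (n := 32) (by norm_num)
  have h32 : Real.log (32 : ℕ) = 5 * Real.log 2 := by
    rw [show ((32 : ℕ) : ℝ) = 2 ^ 5 by norm_num, Real.log_pow]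
    norm_num
  have hl := Real.log_two_lt_d9
  have hh : (4.0584 : ℝ) < (harmonic 32 : ℝ) := by
    have : (4.0584 : ℚ) < harmonic 32 := by
      norm_num [harmonic, Finset.sum_range_succ]
    have h2 : ((4.0584 : ℚ) : ℝ) < (harmonic 32 : ℝ) := by exact_mod_cast this
    refine lt_of_eq_of_lt ?_ h2
    norm_num
  rw [h32] at h
  have hg : (0.577 : ℝ) ≤ Real.eulerMascheroniConstant := by
    norm_num at h hl hh ⊢
    linarith
  refine lt_of_lt_of_le ?_ (Real.exp_le_exp.2 hg)
  have := Real.sum_le_exp_of_nonneg (x := 0.577) (by norm_num) 8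
  refine lt_of_lt_of_le ?_ this
  norm_num [Finset.sum_range_succ, Nat.factorial]

theorem totient_primorial_mul_exp (X : ℕ) :
    ((primorial X).totient : ℝ) * Real.exp (eulerProductLog X) = primorial X := by
  have h : ((primorial X).totient : ℚ) = primorial X * ∏ p ∈ Nat.primesLE X, (1 - (p : ℚ)⁻¹) := by
    rw [Nat.totient_eq_mul_prod_factors, primeFactors_primorial]
  have h2 : ((primorial X).totient : ℝ) = primorial X * ∏ p ∈ Nat.primesLE X, (1 - (p : ℝ)⁻¹) := by
    have := congrArg (fun x : ℚ => (x : ℝ)) h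
    push_cast at this
    exact this
  rw [h2, eulerProductLog, Real.exp_sum, mul_assoc, ← Finset.prod_mul_distrib,
    Finset.prod_eq_one, mul_one]
  intro p hp
  have h3 : (2 : ℝ) ≤ p := by exact_mod_cast Nat.two_le_of_mem_primesLE hp
  have h4 : 0 < 1 - 1 / (p : ℝ) := by
    rw [sub_pos, div_lt_one (by linarith)]; linarith
  rw [eulerFactorLog, Real.exp_neg, Real.exp_log h4, ← one_div, mul_inv_cancel₀ h4.ne']

theorem eventually_log_log_le_primorial : ∀ᶠ X : ℕ in atTop,
    1.7802 * Real.log (Real.log (2 * (primorial X).totient : ℕ)) * (primorial X).totient ≤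
      primorial X := by
  have hlogX : Tendsto (fun X : ℕ => Real.log X) atTop atTop :=
    Real.tendsto_log_atTop.comp tendsto_natCast_atTop_atTop
  filter_upwards [eventually_le_eulerProductLog (δ := 0.0001) (by norm_num),
    eventually_ge_atTop 2, hlogX.eventually_ge_atTop 40000] with X hX hX2 hX3
  have hX0 : (2 : ℝ) ≤ X := by exact_mod_cast hX2
  have hφ : 1 ≤ (primorial X).totient := Nat.totient_pos.2 (primorial_pos X)
  have hφm : (2 * (primorial X).totient : ℕ) ≤ 4 ^ (X + 1) := by
    have h1 := Nat.totient_le (primorial X)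
    have h2 := primorial_le_four_pow X
    rw [pow_succ]
    omega
  have h4 : Real.log 4 ≤ 2 := by
    rw [show (4 : ℝ) = 2 ^ 2 by norm_num, Real.log_pow]
    have := Real.log_two_lt_d9
    norm_num; linarith
  have hll : Real.log (Real.log (2 * (primorial X).totient : ℕ)) ≤ Real.log X + 2 := by
    have h1 : Real.log (2 * (primorial X).totient : ℕ) ≤ (X + 1) * Real.log 4 := by
      have h := Real.log_le_log (x := ((2 * (primorial X).totient : ℕ) : ℝ))
        (by exact_mod_cast (by omega : 0 < 2 * (primorial X).totient))
        (y := ((4 ^ (X + 1) : ℕ) : ℝ)) (by exact_mod_cast hφm)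
      refine h.trans (le_of_eq ?_)
      push_cast
      rw [Real.log_pow]
      push_cast
      ring
    have h2 : 0 < Real.log (2 * (primorial X).totient : ℕ) :=
      Real.log_pos (by exact_mod_cast (by omega : 1 < 2 * (primorial X).totient))
    have h3 : Real.log (2 * (primorial X).totient : ℕ) ≤ X * 4 := by nlinarith
    refine (Real.log_le_log h2 h3).trans ?_
    rw [Real.log_mul (by linarith) (by norm_num)]
    linarith
  have hexp : 1.7803 * Real.log X ≤ Real.exp (eulerProductLog X) := by
    refine le_trans ?_ (Real.exp_le_exp.2 hX)
    rw [add_sub_assoc, Real.exp_add, Real.exp_log (by linarith), mul_comm,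
      sub_eq_add_neg, Real.exp_add]
    refine mul_le_mul_of_nonneg_left ?_ (by linarith)
    have h1 := lt_exp_eulerMascheroniConstant
    have h2 := Real.add_one_le_exp (-0.0001 : ℝ)
    have h3 := mul_le_mul h1.le h2 (by norm_num) (Real.exp_pos _).le
    refine le_trans ?_ h3
    norm_num
  rw [← totient_primorial_mul_exp, mul_comm]
  refine mul_le_mul_of_nonneg_left (le_trans ?_ hexp) (Nat.cast_nonneg _)
  linarith

section LatticeGeometry

variable {E : Type*} [NormedAddCommGroup E] [InnerProductSpace ℝ E]

/-- Rounding the coefficients of a real combination one vector at a time. -/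
theorem exists_norm_sub_sq_le {ι : Type*} (L : Submodule ℤ E) (e : ι → E) (he : ∀ i, e i ∈ L)
    (t : ι → ℝ) (s : Finset ι) :
    ∃ x ∈ L, ‖∑ i ∈ s, t i • e i - x‖ ^ 2 ≤ (1 / 4) * ∑ i ∈ s, ‖e i‖ ^ 2 := by
  classical
  induction s using Finset.induction_on with
  | empty => exact ⟨0, L.zero_mem, by simp⟩
  | insert i s hi ih =>
    obtain ⟨x, hx, hle⟩ := ih
    set w := ∑ i ∈ s, t i • e i - x with hw
    set f := Int.fract (t i) with hf
    have hf0 : 0 ≤ f := Int.fract_nonneg _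
    have hf1 : f < 1 := Int.fract_lt_one _
    have hn (c : ℝ) : ‖w + c • e i‖ ^ 2 = ‖w‖ ^ 2 + 2 * c * inner ℝ w (e i) + c ^ 2 * ‖e i‖ ^ 2 := by
      rw [norm_add_sq_real, norm_smul, inner_smul_right, mul_pow, Real.norm_eq_abs, sq_abs]
      ring
    have hsplit : ∃ c : ℝ, (c = f ∨ c = f - 1) ∧ ‖w + c • e i‖ ^ 2 ≤ ‖w‖ ^ 2 + (1 / 4) * ‖e i‖ ^ 2 := by
      by_contra! h
      have h1 := h f (Or.inl rfl)
      have h2 := h (f - 1) (Or.inr rfl)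
      rw [hn] at h1 h2
      have h3 : 0 ≤ ‖e i‖ ^ 2 := by positivity
      have h4 := mul_lt_mul_of_pos_left h1 (sub_pos.2 hf1)
      have h5 := mul_le_mul_of_nonneg_left h2.le hf0
      nlinarith [mul_nonneg h3 (sq_nonneg (2 * f - 1))]
    obtain ⟨c, hc, hcle⟩ := hsplit
    have hk : ∃ k : ℤ, t i = c + k := by
      rcases hc with rfl | rfl
      · exact ⟨⌊t i⌋, by rw [hf, Int.fract_add_floor]⟩
      · refine ⟨⌊t i⌋ + 1, ?_⟩
        have := Int.fract_add_floor (t i)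
        push_cast
        linarith
    obtain ⟨k, hk⟩ := hk
    refine ⟨x + k • e i, L.add_mem hx (L.smul_mem k (he i)), ?_⟩
    rw [Finset.sum_insert hi, Finset.sum_insert hi]
    have : t i • e i + ∑ i ∈ s, t i • e i - (x + k • e i) = w + c • e i := by
      rw [hw, hk, add_smul, Int.cast_smul_eq_zsmul]
      abel
    rw [this]
    linarith

theorem le_latticeMinimum [Nontrivial E] (L : Submodule ℤ E) [DiscreteTopology L] [IsZLattice ℝ L]
    {r : ℝ} (h : ∀ x ∈ L, x ≠ 0 → r ≤ ‖x‖) : r ≤ latticeMinimum L := by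
  refine le_csInf ?_ ?_
  · by_contra hne
    rw [Set.not_nonempty_iff_eq_empty] at hne
    have h0 : ∀ x ∈ L, x = 0 := fun x hx => by
      by_contra hx0
      have : ‖x‖ ∈ {r : ℝ | ∃ x ∈ L, x ≠ 0 ∧ r = ‖x‖} := ⟨x, hx, hx0, rfl⟩
      rw [hne] at this
      exact this
    have hspan := IsZLattice.span_top (K := ℝ) (L := L)
    rw [Submodule.span_eq_bot.2 h0] at hspan
    exact bot_ne_top hspan
  · rintro _ ⟨x, hx, hx0, rfl⟩
    exact h x hx hx0

variable [FiniteDimensional ℝ E] [MeasurableSpace E] [BorelSpace E]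

open scoped Pointwise in
theorem card_mul_covolume_le (L : Submodule ℤ E) [DiscreteTopology L] [IsZLattice ℝ L] {τ r : ℝ}
    (hτ : ∀ z : E, ∃ x ∈ L, ‖z - x‖ ≤ τ) (S : Finset E) (hS : ∀ x ∈ S, x ∈ L ∧ ‖x‖ ≤ r) :
    S.card * ZLattice.covolume L volume ≤
      (volume : Measure E).real (Metric.closedBall 0 (r + τ)) := by
  classical
  have := ZLattice.module_free ℝ L
  have := ZLattice.module_finite ℝ L
  let b := Module.Free.chooseBasis ℤ L
  have hD := ZLattice.isAddFundamentalDomain b (volume : Measure E)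
  have : MeasurableVAdd L E := (inferInstance : MeasurableVAdd L.toAddSubgroup E)
  have : VAddInvariantMeasure L E (volume : Measure E) :=
    (inferInstance : VAddInvariantMeasure L.toAddSubgroup E volume)
  set D := ZSpan.fundamentalDomain (b.ofZLatticeBasis ℝ)
  set B := Metric.closedBall (0 : E) (r + τ)
  have hB : MeasurableSet B := Metric.isClosed_closedBall.measurableSet
  have key : (S.card : ENNReal) * volume D ≤ volume B := by
    have h1 : ∀ g : L, volume ((g +ᵥ B) ∩ D) = ∫⁻ z in D, (g +ᵥ B).indicator 1 z := fun g => by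
      rw [lintegral_indicator_one (hB.const_vadd g), Measure.restrict_apply (hB.const_vadd g)]
    rw [(hD.measure_eq_tsum B).trans (tsum_congr h1), ← lintegral_tsum fun g => (measurable_one.indicator (hB.const_vadd g)).aemeasurable,
      ← setLIntegral_const]
    refine lintegral_mono fun z => ?_
    obtain ⟨x, hx, hxz⟩ := hτ z
    let T : Finset L := S.attach.image fun y : S => ⟨x + y.1, L.add_mem hx (hS y y.2).1⟩
    have hT : T.card = S.card := by
      rw [Finset.card_image_of_injective, Finset.card_attach]
      intro y y' h
      exact Subtype.ext (add_left_cancel (congrArg Subtype.val h))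
    refine le_trans ?_ (ENNReal.sum_le_tsum T)
    rw [← hT, Finset.sum_congr rfl (g := fun _ => 1), Finset.sum_const, nsmul_one]
    intro g hg
    simp only [T, Finset.mem_image, Finset.mem_attach, true_and] at hg
    obtain ⟨y, rfl⟩ := hg
    rw [Set.indicator_of_mem, Pi.one_apply]
    rw [Set.mem_vadd_set_iff_neg_vadd_mem]
    have h2 : ‖z - x - y.1‖ ≤ τ + r := (norm_sub_le _ _).trans (add_le_add hxz (hS y y.2).2)
    simp only [B, mem_closedBall_zero_iff, Submodule.vadd_def, vadd_eq_add]
    convert! h2 using 1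
    · congr 1
      simp
      abel
    · ring
  rw [ZLattice.covolume_eq_measure_fundamentalDomain L volume hD]
  have h3 := ENNReal.toReal_mono (measure_closedBall_lt_top).ne key
  simpa [ENNReal.toReal_mul] using! h3

theorem volume_ball_le_covolume (L : Submodule ℤ E) [DiscreteTopology L] [IsZLattice ℝ L] {μ : ℝ}
    (hμ : ∀ x ∈ L, x ≠ 0 → μ ≤ ‖x‖) :
    (volume : Measure E).real (Metric.ball 0 μ) ≤
      ZLattice.covolume L volume * 2 ^ Module.finrank ℝ E := by
  have := ZLattice.module_free ℝ L
  have := ZLattice.module_finite ℝ L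
  let b := Module.Free.chooseBasis ℤ L
  have hD := ZLattice.isAddFundamentalDomain b (volume : Measure E)
  rw [ZLattice.covolume_eq_measure_fundamentalDomain L volume hD]
  by_contra! h
  have hDfin : volume (ZSpan.fundamentalDomain (b.ofZLatticeBasis ℝ)) ≠ ⊤ :=
    (ZSpan.fundamentalDomain_isBounded _).measure_lt_top.ne
  have : Countable L.toAddSubgroup := (inferInstance : Countable L)
  obtain ⟨x, hx0, hx⟩ := exists_ne_zero_mem_lattice_of_measure_mul_two_pow_lt_measure
    (L := L.toAddSubgroup) (s := Metric.ball (0 : E) μ) hD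
    (fun x hx => by simpa using hx) (convex_ball _ _) (by
      rw [← ENNReal.toReal_lt_toReal (ENNReal.mul_ne_top hDfin (by simp)) measure_ball_lt_top.ne]
      simpa [ENNReal.toReal_mul] using! h)
  have := hμ x x.2 (by simpa using hx0)
  simp at hx
  linarith

/-- If the lattices `L i` meet pairwise in long vectors only, and their nonzero vectors come in
sets of `m` vectors of equal norm, then one of them has a large minimum. -/
theorem exists_latticeDensity_ge [Nontrivial E] {ι : Type*} [Fintype ι] (L₀ : Submodule ℤ E)
    [DiscreteTopology L₀] [IsZLattice ℝ L₀] (L : ι → Submodule ℤ E) (hL : ∀ i, L i ≤ L₀)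
    [∀ i, DiscreteTopology (L i)] [∀ i, IsZLattice ℝ (L i)]
    (hind : ∀ i, (L i).toAddSubgroup.relIndex L₀.toAddSubgroup = Fintype.card ι) {m : ℕ}
    (horb : ∀ i, ∀ x ∈ L i, x ≠ 0 →
      ∃ T : Finset E, T.card = m ∧ ∀ y ∈ T, y ∈ L i ∧ y ≠ 0 ∧ ‖y‖ = ‖x‖)
    {r τ : ℝ} (hτ : ∀ z : E, ∃ x ∈ L₀, ‖z - x‖ ≤ τ)
    (hdisj : ∀ i j, i ≠ j → ∀ x ∈ L i, x ∈ L j → x ≠ 0 → r < ‖x‖)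
    (hvol : (volume : Measure E).real (Metric.closedBall 0 (r + τ)) <
      m * Fintype.card ι * ZLattice.covolume L₀ volume) :
    ∃ i, (volume : Measure E).real (Metric.closedBall 0 r) /
      (2 ^ Module.finrank ℝ E * (Fintype.card ι * ZLattice.covolume L₀ volume)) ≤
        latticeDensity (L i) := by
  classical
  have hex : ∃ i, ∀ x ∈ L i, x ≠ 0 → r < ‖x‖ := by
    by_contra! hne
    choose x hxL hx0 hxr using hne
    choose T hTm hT using fun i => horb i (x i) (hxL i) (hx0 i)
    have hcard : (Finset.univ.biUnion T).card = Fintype.card ι * m := by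
      rw [Finset.card_biUnion, Finset.sum_congr rfl fun i _ => hTm i]
      · simp
      · intro i _ j _ hij
        refine Finset.disjoint_left.2 fun y hyi hyj => ?_
        have h1 := hdisj i j hij y (hT i y hyi).1 (hT j y hyj).1 (hT i y hyi).2.1
        rw [(hT i y hyi).2.2] at h1
        exact absurd (hxr i) (not_le.2 h1)
    have h := card_mul_covolume_le L₀ hτ (Finset.univ.biUnion T) (r := r) fun y hy => by
      simp only [Finset.mem_biUnion, Finset.mem_univ, true_and] at hy
      obtain ⟨i, hy⟩ := hy
      exact ⟨hL i (hT i y hy).1, (hT i y hy).2.2.le.trans (hxr i)⟩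
    rw [hcard] at h
    push_cast at h
    rw [mul_comm (Fintype.card ι : ℝ)] at h
    linarith
  obtain ⟨i, hi⟩ := hex
  refine ⟨i, ?_⟩
  have hc := ZLattice.covolume_div_covolume_eq_relIndex' (L i) L₀ (hL i)
  rw [hind, div_eq_iff (ZLattice.covolume_ne_zero L₀ volume)] at hc
  rw [latticeDensity, hc]
  have hpos := ZLattice.covolume_pos L₀ volume
  refine div_le_div_of_nonneg_right ?_ (by positivity)
  refine measureReal_mono (Metric.closedBall_subset_closedBall ?_) measure_closedBall_lt_top.ne
  exact le_latticeMinimum (L i) fun x hx hx0 => (hi x hx hx0).le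

theorem exists_latticeDensity_ge_of_le {ι : Type*} [Fintype ι] (L₀ : Submodule ℤ E)
    [DiscreteTopology L₀] [IsZLattice ℝ L₀] (L : ι → Submodule ℤ E) (hL : ∀ i, L i ≤ L₀)
    [∀ i, DiscreteTopology (L i)] [∀ i, IsZLattice ℝ (L i)]
    (hind : ∀ i, (L i).toAddSubgroup.relIndex L₀.toAddSubgroup = Fintype.card ι) {m : ℕ}
    (horb : ∀ i, ∀ x ∈ L i, x ≠ 0 →
      ∃ T : Finset E, T.card = m ∧ ∀ y ∈ T, y ∈ L i ∧ y ≠ 0 ∧ ‖y‖ = ‖x‖)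
    {d : ℕ} (hd : 1 ≤ d) (hE : Module.finrank ℝ E = 2 * d)
    (hmin : ∀ x ∈ L₀, x ≠ 0 → (d : ℝ) ≤ ‖x‖ ^ 2)
    (hτ : ∀ z : E, ∃ x ∈ L₀, ‖z - x‖ ^ 2 ≤ (d : ℝ) ^ 2 / 2)
    {Q : ℝ} (hQ0 : 0 ≤ Q) (hQ : Q ^ d = Fintype.card ι)
    (hdisj : ∀ i j, i ≠ j → ∀ x ∈ L i, x ∈ L j → x ≠ 0 → d * Q ^ 2 ≤ ‖x‖ ^ 2)
    {ε : ℝ} (hε0 : 0 < ε) (hε1 : ε < 1) (hm : 1 ≤ (1 - ε) * m)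
    (hQ1 : 8 * (d : ℝ) ^ 3 / ε ^ 2 ≤ Q) (hQ2 : (d : ℝ) ^ 2 * m < Q) :
    ∃ i, (1 - ε) * m / 2 ^ (2 * d) ≤ latticeDensity (L i) := by
  have : Nontrivial E := Module.nontrivial_of_finrank_pos (R := ℝ) (by omega)
  have hd0 : (1 : ℝ) ≤ d := by exact_mod_cast hd
  have hm1 : (1 : ℝ) ≤ m := by
    have : (0 : ℝ) ≤ m := Nat.cast_nonneg m
    nlinarith
  have hQpos : 1 < Q := lt_of_le_of_lt (by nlinarith) hQ2
  set V := ZLattice.covolume L₀ volume with hV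
  have hVpos : 0 < V := ZLattice.covolume_pos L₀ volume
  set v := (volume : Measure E).real (Metric.ball 0 1) with hv
  have hvpos : 0 < v := ENNReal.toReal_pos (Metric.measure_ball_pos _ _ one_pos).ne' measure_ball_lt_top.ne
  have hball {ρ : ℝ} (hρ : 0 ≤ ρ) :
      (volume : Measure E).real (Metric.closedBall 0 ρ) = (ρ ^ 2) ^ d * v := by
    rw [Measure.addHaar_real_closedBall _ _ hρ, hE, pow_mul]
  set τ := √((d : ℝ) ^ 2 / 2) with hτd
  have hτ0 : 0 ≤ τ := Real.sqrt_nonneg _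
  have hτ2 : τ ^ 2 = (d : ℝ) ^ 2 / 2 := Real.sq_sqrt (by positivity)
  have hτ' : ∀ z : E, ∃ x ∈ L₀, ‖z - x‖ ≤ τ := fun z => by
    obtain ⟨x, hx, h⟩ := hτ z
    exact ⟨x, hx, Real.le_sqrt_of_sq_le h⟩
  have hVlow : (d : ℝ) ^ d * v ≤ V * 4 ^ d := by
    have h := volume_ball_le_covolume L₀ (μ := √d) fun x hx hx0 =>
      Real.sqrt_le_iff.2 ⟨norm_nonneg _, hmin x hx hx0⟩
    rw [← Measure.addHaar_real_closedBall_eq_addHaar_real_ball, hball (Real.sqrt_nonneg _), hE,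
      Real.sq_sqrt (by positivity), pow_mul] at h
    norm_num at h
    exact h
  have hVup : V ≤ ((d : ℝ) ^ 2 / 2) ^ d * v := by
    have h := card_mul_covolume_le L₀ hτ' {0} (r := 0) (by simp)
    rw [zero_add, hball hτ0, hτ2] at h
    simpa using h
  set A := (1 - ε) * m * Q ^ d * V / v with hA
  have hA0 : 0 ≤ A := by
    have : 0 < 1 - ε := by linarith
    positivity
  set R := A ^ (1 / (d : ℝ)) with hR
  have hR0 : 0 ≤ R := by positivity
  have hRd : R ^ d = A := by
    rw [hR, one_div]
    exact Real.rpow_inv_natCast_pow hA0 (by omega)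
  have hRv : R ^ d * v = (1 - ε) * m * Q ^ d * V := by
    rw [hRd, hA]
    field_simp
  set r := √R with hr
  have hr0 : 0 ≤ r := Real.sqrt_nonneg _
  have hr2 : r ^ 2 = R := Real.sq_sqrt hR0
  have hRlt : R < d * Q ^ 2 := by
    refine lt_of_pow_lt_pow_left₀ d (by positivity) (lt_of_mul_lt_mul_right ?_ hvpos.le)
    rw [hRv]
    calc (1 - ε) * m * Q ^ d * V < m * Q ^ d * V := by
          have : 0 < m * Q ^ d * V := by positivity
          nlinarith
      _ ≤ m ^ d * Q ^ d * (((d : ℝ) ^ 2 / 2) ^ d * v) := by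
          gcongr
          exact le_self_pow₀ hm1 (by omega)
      _ = (m * Q * ((d : ℝ) ^ 2 / 2)) ^ d * v := by rw [mul_pow, mul_pow]; ring
      _ ≤ (d * Q ^ 2) ^ d * v := by
          refine mul_le_mul_of_nonneg_right (pow_le_pow_left₀ (by positivity) ?_ d) hvpos.le
          nlinarith [mul_le_mul_of_nonneg_right hQ2.le hQ0, mul_nonneg hQ0 hQ0]
  have hRge : 2 * (d : ℝ) ^ 4 / ε ^ 2 ≤ R := by
    refine le_of_pow_le_pow_left₀ (n := d) (by omega) hR0 (le_of_mul_le_mul_right ?_ hvpos)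
    rw [hRv]
    calc (2 * (d : ℝ) ^ 4 / ε ^ 2) ^ d * v = (d / 4 * (8 * (d : ℝ) ^ 3 / ε ^ 2)) ^ d * v := by
          congr 2; ring
      _ ≤ (d / 4 * Q) ^ d * v := by gcongr
      _ = Q ^ d * ((d : ℝ) ^ d * v) / 4 ^ d := by rw [mul_pow, div_pow]; ring
      _ ≤ Q ^ d * (V * 4 ^ d) / 4 ^ d := by gcongr
      _ = 1 * Q ^ d * V := by field_simp
      _ ≤ (1 - ε) * m * Q ^ d * V := by gcongr
  have hτr : τ ≤ r * (ε / (2 * d)) := by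
    refine le_of_pow_le_pow_left₀ two_ne_zero (by positivity) ?_
    rw [hτ2, mul_pow, hr2]
    rw [div_le_iff₀ (by positivity)] at hRge
    rw [div_pow, ← mul_div_assoc, le_div_iff₀ (by positivity)]
    nlinarith
  have hvol : (volume : Measure E).real (Metric.closedBall 0 (r + τ)) <
      m * Fintype.card ι * V := by
    rw [hball (by positivity), ← hQ]
    have h1 : (r + τ) ^ 2 ≤ R * Real.exp (ε / d) := by
      have h2 : r + τ ≤ r * Real.exp (ε / (2 * d)) := by
        have := mul_le_mul_of_nonneg_left (Real.add_one_le_exp (ε / (2 * d))) hr0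
        linarith
      calc (r + τ) ^ 2 ≤ (r * Real.exp (ε / (2 * d))) ^ 2 := by gcongr
        _ = R * Real.exp (ε / d) := by
          rw [mul_pow, hr2, ← Real.exp_nat_mul]
          congr 2
          push_cast
          field_simp
    calc ((r + τ) ^ 2) ^ d * v ≤ (R * Real.exp (ε / d)) ^ d * v := by gcongr
      _ = Real.exp ε * (R ^ d * v) := by
          rw [mul_pow, ← Real.exp_nat_mul, mul_div_cancel₀ ε (by linarith : (d : ℝ) ≠ 0)]
          ring
      _ = (Real.exp ε * (1 - ε)) * (m * Q ^ d * V) := by rw [hRv]; ring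
      _ < 1 * (m * Q ^ d * V) := by
          refine mul_lt_mul_of_pos_right ?_ (by positivity)
          have h3 := Real.add_one_lt_exp (x := -ε) (by linarith)
          have h4 := mul_lt_mul_of_pos_left h3 (Real.exp_pos ε)
          rw [← Real.exp_add, add_neg_cancel, Real.exp_zero] at h4
          linarith
      _ = _ := by ring
  obtain ⟨i, hi⟩ := exists_latticeDensity_ge L₀ L hL hind horb hτ' (r := r)
    (fun i j hij x hxi hxj hx0 => by
      refine lt_of_pow_lt_pow_left₀ 2 (norm_nonneg _) ?_
      rw [hr2]
      exact hRlt.trans_le (hdisj i j hij x hxi hxj hx0)) hvol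
  refine ⟨i, le_trans (le_of_eq ?_) hi⟩
  rw [hball hr0, hr2, hRv, hE, ← hQ, ← hV]
  field_simp

end LatticeGeometry

section CyclotomicGeometry

variable (m : ℕ) [NeZero m]

namespace CyclotomicRealSpace

theorem extendEmbedding_of (φ : CyclotomicField m ℚ →+* ℂ) (k : CyclotomicField m ℚ) :
    extendEmbedding m φ (of m k) = φ k :=
  (extendEmbedding_tmul m φ 1 k).trans (by simp)

theorem norm_sq_of (k : CyclotomicField m ℚ) :
    ‖of m k‖ ^ 2 = ∑ φ : CyclotomicField m ℚ →+* ℂ, ‖φ k‖ ^ 2 := by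
  rw [← real_inner_self_eq_norm_sq]
  refine (traceForm_self m (of m k)).trans ?_
  simp_rw [extendEmbedding_of]

theorem of_injective : Function.Injective (of m) := fun x y h => by
  let φ : CyclotomicField m ℚ →+* ℂ := Classical.arbitrary _
  apply φ.injective
  rw [← extendEmbedding_of, h, extendEmbedding_of]

theorem card_embeddings : Fintype.card (CyclotomicField m ℚ →+* ℂ) = m.totient := by
  rw [NumberField.Embeddings.card (CyclotomicField m ℚ) ℂ]
  exact IsCyclotomicExtension.finrank _ (Polynomial.cyclotomic.irreducible_rat (NeZero.pos m))

theorem totient_mul_sq_le_norm_sq_of (k : 𝓞 (CyclotomicField m ℚ)) {Q : ℝ} (hQ : 0 ≤ Q)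
    (h : Q ^ m.totient ≤ ((Algebra.norm ℤ k).natAbs : ℝ)) :
    m.totient * Q ^ 2 ≤ ‖of m (k : CyclotomicField m ℚ)‖ ^ 2 := by
  have hd : 0 < m.totient := Nat.totient_pos.2 (NeZero.pos m)
  have hd0 : (0 : ℝ) < m.totient := by exact_mod_cast hd
  have hprod : ∏ φ : CyclotomicField m ℚ →+* ℂ, ‖φ (k : CyclotomicField m ℚ)‖ ^ 2 =
      ((Algebra.norm ℤ k).natAbs : ℝ) ^ 2 := by
    rw [Finset.prod_pow]
    congr 1
    have h1 := Algebra.norm_eq_prod_embeddings ℚ ℂ (k : CyclotomicField m ℚ)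
    have h2 := congrArg norm h1
    rw [norm_prod] at h2
    rw [Fintype.prod_equiv (RingHom.equivRatAlgHom (CyclotomicField m ℚ) ℂ)
      (fun φ => ‖φ (k : CyclotomicField m ℚ)‖) (fun φ => ‖φ (k : CyclotomicField m ℚ)‖)
      (fun _ => rfl), ← h2, ← Algebra.coe_norm_int k]
    simp [Nat.cast_natAbs]
  have hgm := Real.geom_mean_le_arith_mean_weighted Finset.univ
    (fun _ : CyclotomicField m ℚ →+* ℂ => 1 / (m.totient : ℝ))
    (fun φ => ‖φ (k : CyclotomicField m ℚ)‖ ^ 2) (fun _ _ => by positivity)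
    (by
      rw [Finset.sum_const, Finset.card_univ, card_embeddings, nsmul_eq_mul]
      field_simp) (fun _ _ => by positivity)
  rw [← Finset.mul_sum, ← norm_sq_of, Real.finsetProd_rpow _ _ (fun _ _ => by positivity),
    hprod] at hgm
  have h3 : Q ^ 2 ≤ (((Algebra.norm ℤ k).natAbs : ℝ) ^ 2) ^ (1 / (m.totient : ℝ)) := by
    calc Q ^ 2 = ((Q ^ 2) ^ m.totient) ^ (1 / (m.totient : ℝ)) := by
          rw [one_div, Real.pow_rpow_inv_natCast (by positivity) hd.ne']
      _ ≤ _ := by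
          refine Real.rpow_le_rpow (by positivity) ?_ (by positivity)
          rw [← pow_mul, mul_comm 2, pow_mul]
          exact pow_le_pow_left₀ (by positivity) h 2
  have h4 := h3.trans hgm
  rwa [one_div, inv_mul_eq_div, le_div_iff₀' hd0] at h4

end CyclotomicRealSpace

open CyclotomicRealSpace

/-- The embedding of `ℤ[ζ_m]²` into the Euclidean plane over `ℚ(ζ_m) ⊗ ℝ`. -/
noncomputable def integerPlaneHom : (Fin 2 → 𝓞 (CyclotomicField m ℚ)) →+ CyclotomicPlane m where
  toFun a := WithLp.toLp 2 fun i => of m (a i : CyclotomicField m ℚ)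
  map_zero' := by ext i; simp
  map_add' a b := by ext i; simp

theorem integerPlaneHom_apply (a : Fin 2 → 𝓞 (CyclotomicField m ℚ)) (i : Fin 2) :
    integerPlaneHom m a i = of m (a i : CyclotomicField m ℚ) := rfl

theorem integerPlaneHom_injective : Function.Injective (integerPlaneHom m) := fun a b h => by
  funext i
  have := congrArg (fun v : CyclotomicPlane m => v i) h
  exact RingOfIntegers.ext (of_injective m this)

theorem norm_sq_integerPlaneHom (a : Fin 2 → 𝓞 (CyclotomicField m ℚ)) :
    ‖integerPlaneHom m a‖ ^ 2 = ∑ i, ‖of m (a i : CyclotomicField m ℚ)‖ ^ 2 :=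
  PiLp.norm_sq_eq_of_L2 _ _

theorem totient_mul_sq_le_norm_sq_integerPlaneHom {a : Fin 2 → 𝓞 (CyclotomicField m ℚ)} (ha : a ≠ 0)
    {Q : ℝ} (hQ : 0 ≤ Q)
    (h : ∀ i, a i ≠ 0 → Q ^ m.totient ≤ ((Algebra.norm ℤ (a i)).natAbs : ℝ)) :
    m.totient * Q ^ 2 ≤ ‖integerPlaneHom m a‖ ^ 2 := by
  obtain ⟨i, hi⟩ := Function.ne_iff.1 ha
  rw [norm_sq_integerPlaneHom]
  exact (totient_mul_sq_le_norm_sq_of m (a i) hQ (h i hi)).trans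
    (Finset.single_le_sum (f := fun i => ‖of m (a i : CyclotomicField m ℚ)‖ ^ 2)
      (fun _ _ => by positivity) (Finset.mem_univ i))

theorem totient_le_norm_sq_integerPlaneHom {a : Fin 2 → 𝓞 (CyclotomicField m ℚ)} (ha : a ≠ 0) :
    (m.totient : ℝ) ≤ ‖integerPlaneHom m a‖ ^ 2 := by
  have := totient_mul_sq_le_norm_sq_integerPlaneHom m ha zero_le_one fun i hi => by
    rw [one_pow, Nat.one_le_cast, Nat.one_le_iff_ne_zero, Int.natAbs_ne_zero]
    exact Algebra.norm_ne_zero_iff.2 hi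
  simpa using this

/-- A primitive `m`-th root of unity in `ℤ[ζ_m]`. -/
noncomputable def integerZeta : 𝓞 (CyclotomicField m ℚ) :=
  (IsCyclotomicExtension.zeta_spec m ℚ (CyclotomicField m ℚ)).toInteger

theorem integerZeta_isPrimitiveRoot : IsPrimitiveRoot (integerZeta m) m :=
  (IsCyclotomicExtension.zeta_spec m ℚ (CyclotomicField m ℚ)).toInteger_isPrimitiveRoot

theorem norm_sq_of_integerZeta_pow_mul (i : ℕ) (k : 𝓞 (CyclotomicField m ℚ)) :
    ‖of m ((integerZeta m ^ i * k : 𝓞 (CyclotomicField m ℚ)) : CyclotomicField m ℚ)‖ ^ 2 =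
      ‖of m (k : CyclotomicField m ℚ)‖ ^ 2 := by
  rw [norm_sq_of, norm_sq_of]
  refine Finset.sum_congr rfl fun φ _ => ?_
  have h : ‖φ (integerZeta m : CyclotomicField m ℚ)‖ = 1 := by
    refine Complex.norm_eq_one_of_pow_eq_one (n := m) ?_ (NeZero.ne m)
    rw [← map_pow, ← map_pow, (integerZeta_isPrimitiveRoot m).pow_eq_one, map_one, map_one]
  have hk : ((integerZeta m ^ i * k : 𝓞 (CyclotomicField m ℚ)) : CyclotomicField m ℚ) =
      (integerZeta m : CyclotomicField m ℚ) ^ i * k := rfl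
  rw [hk, map_mul, map_pow, norm_mul, norm_pow, h, one_pow, one_mul]

theorem norm_integerPlaneHom_integerZeta_pow_smul (i : ℕ)
    (a : Fin 2 → 𝓞 (CyclotomicField m ℚ)) :
    ‖integerPlaneHom m (integerZeta m ^ i • a)‖ = ‖integerPlaneHom m a‖ := by
  rw [← sq_eq_sq₀ (norm_nonneg _) (norm_nonneg _), norm_sq_integerPlaneHom,
    norm_sq_integerPlaneHom]
  exact Finset.sum_congr rfl fun j _ => norm_sq_of_integerZeta_pow_mul m i (a j)

theorem norm_sq_of_integerZeta_pow (i : ℕ) :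
    ‖of m ((integerZeta m ^ i : 𝓞 (CyclotomicField m ℚ)) : CyclotomicField m ℚ)‖ ^ 2 =
      m.totient := by
  have h := norm_sq_of_integerZeta_pow_mul m i 1
  rw [mul_one] at h
  rw [h, norm_sq_of, ← card_embeddings]
  simp

/-- The vectors of `ℤ[ζ_m]²` that have one coordinate a power of `ζ_m` and the other zero. -/
noncomputable def zetaVector (ji : Fin 2 × Fin m.totient) : Fin 2 → 𝓞 (CyclotomicField m ℚ) :=
  Pi.single ji.1 (integerZeta m ^ (ji.2 : ℕ))

theorem norm_sq_zetaVector (ji : Fin 2 × Fin m.totient) :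
    ‖integerPlaneHom m (zetaVector m ji)‖ ^ 2 = m.totient := by
  rw [norm_sq_integerPlaneHom, Finset.sum_eq_single ji.1]
  · rw [zetaVector, Pi.single_eq_same, norm_sq_of_integerZeta_pow]
  · intro j _ hj
    rw [zetaVector, Pi.single_eq_of_ne hj]
    simp
  · simp

theorem exists_eq_sum_zetaVector (z : CyclotomicPlane m) :
    ∃ t : Fin 2 × Fin m.totient → ℝ, z = ∑ ji, t ji • integerPlaneHom m (zetaVector m ji) := by
  have hζ := IsCyclotomicExtension.zeta_spec m ℚ (CyclotomicField m ℚ)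
  let pb := hζ.powerBasis ℚ
  have hdim : pb.dim = m.totient := by
    rw [← pb.finrank]
    exact IsCyclotomicExtension.finrank _ (Polynomial.cyclotomic.irreducible_rat (NeZero.pos m))
  let c := pb.basis.reindex (finCongr hdim)
  let b : Module.Basis (Fin m.totient) ℝ (CyclotomicRealSpace m) :=
    Algebra.TensorProduct.basis ℝ c
  have hb : ∀ i, b i =
      of m ((integerZeta m ^ (i : ℕ) : 𝓞 (CyclotomicField m ℚ)) : CyclotomicField m ℚ) := by
    intro i
    have h1 : b i = of m (c i) := Algebra.TensorProduct.basis_apply _ _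
    rw [h1]
    congr 1
    simp [c, pb, integerZeta]
    rfl
  refine ⟨fun ji => b.repr (z ji.1) ji.2, ?_⟩
  ext j
  rw [WithLp.ofLp_sum, Finset.sum_apply, Fintype.sum_prod_type, Finset.sum_eq_single j]
  · conv_lhs => rw [← b.sum_repr (z j)]
    refine Finset.sum_congr rfl fun i _ => ?_
    rw [PiLp.smul_apply, integerPlaneHom_apply, zetaVector, Pi.single_eq_same, hb]
  · intro j' _ hj
    refine Finset.sum_eq_zero fun i _ => ?_
    rw [PiLp.smul_apply, integerPlaneHom_apply, zetaVector, Pi.single_eq_of_ne hj.symm]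
    simp
  · simp

end CyclotomicGeometry

theorem card_quotient_le_natAbs_norm {K : Type*} [Field K] [NumberField K] {P : Ideal (𝓞 K)}
    {k : 𝓞 K} (hk : k ∈ P) (hk0 : k ≠ 0) :
    Nat.card (𝓞 K ⧸ P) ≤ (Algebra.norm ℤ k).natAbs := by
  refine Nat.le_of_dvd (Int.natAbs_pos.2 (Algebra.norm_ne_zero_iff.2 hk0)) ?_
  have h := Ideal.absNorm_dvd_absNorm_of_le ((Ideal.span_singleton_le_iff_mem P).2 hk)
  rwa [Ideal.absNorm_span_singleton, Ideal.absNorm_apply] at h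

section CyclotomicLattices

variable {m : ℕ} [NeZero m]

theorem mem_codeLattice {P : Ideal (𝓞 (CyclotomicField m ℚ))}
    {C : Submodule (𝓞 (CyclotomicField m ℚ) ⧸ P) (Fin 2 → 𝓞 (CyclotomicField m ℚ) ⧸ P)}
    {v : CyclotomicPlane m} : v ∈ codeLattice P C ↔
      ∃ a, (fun i => Ideal.Quotient.mk P (a i)) ∈ C ∧ v = integerPlaneHom m a := by
  refine exists_congr fun a => and_congr_right fun _ => ⟨fun h => ?_, fun h i => ?_⟩
  · ext i
    exact h i
  · rw [h]
    rfl

theorem codeLattice_mono {P : Ideal (𝓞 (CyclotomicField m ℚ))}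
    {C C' : Submodule (𝓞 (CyclotomicField m ℚ) ⧸ P) (Fin 2 → 𝓞 (CyclotomicField m ℚ) ⧸ P)}
    (h : C ≤ C') : codeLattice P C ≤ codeLattice P C' := fun _ ⟨a, ha, hv⟩ => ⟨a, h ha, hv⟩

theorem totient_le_norm_sq_of_mem_codeLattice {P : Ideal (𝓞 (CyclotomicField m ℚ))}
    {C : Submodule (𝓞 (CyclotomicField m ℚ) ⧸ P) (Fin 2 → 𝓞 (CyclotomicField m ℚ) ⧸ P)}
    {v : CyclotomicPlane m} (hv : v ∈ codeLattice P C) (hv0 : v ≠ 0) :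
    (m.totient : ℝ) ≤ ‖v‖ ^ 2 := by
  obtain ⟨a, -, rfl⟩ := mem_codeLattice.1 hv
  refine totient_le_norm_sq_integerPlaneHom m ?_
  rintro rfl
  exact hv0 (map_zero _)

instance discreteTopology_codeLattice (P : Ideal (𝓞 (CyclotomicField m ℚ)))
    (C : Submodule (𝓞 (CyclotomicField m ℚ) ⧸ P) (Fin 2 → 𝓞 (CyclotomicField m ℚ) ⧸ P)) :
    DiscreteTopology (codeLattice P C) := by
  refine DiscreteTopology.of_forall_le_dist (r := 1) one_pos fun x y hxy => ?_
  have hne : (x - y : codeLattice P C) ≠ 0 := sub_ne_zero.2 hxy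
  have h := totient_le_norm_sq_of_mem_codeLattice (x - y).2 fun h => hne (Subtype.ext h)
  have h1 : (1 : ℝ) ≤ m.totient := by exact_mod_cast Nat.totient_pos.2 (NeZero.pos m)
  change 1 ≤ dist x y
  rw [Subtype.dist_eq, dist_eq_norm]
  refine le_of_pow_le_pow_left₀ two_ne_zero (norm_nonneg _) ?_
  rw [one_pow]
  exact h1.trans h

theorem isZLattice_codeLattice {P : Ideal (𝓞 (CyclotomicField m ℚ))} {p : ℕ} (hp : p ≠ 0)
    (hpP : (p : 𝓞 (CyclotomicField m ℚ)) ∈ P)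
    (C : Submodule (𝓞 (CyclotomicField m ℚ) ⧸ P) (Fin 2 → 𝓞 (CyclotomicField m ℚ) ⧸ P)) :
    IsZLattice ℝ (codeLattice P C) := by
  refine ⟨eq_top_iff.2 fun z _ => ?_⟩
  obtain ⟨t, rfl⟩ := exists_eq_sum_zetaVector m z
  refine Submodule.sum_mem _ fun ji _ => Submodule.smul_mem _ _ ?_
  have h1 : (p : ℝ) • integerPlaneHom m (zetaVector m ji) ∈
      Submodule.span ℝ (codeLattice P C : Set (CyclotomicPlane m)) := by
    refine Submodule.subset_span (mem_codeLattice.2 ⟨p • zetaVector m ji, ?_, ?_⟩)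
    · convert! C.zero_mem using 1
      funext i
      rw [Pi.smul_apply, nsmul_eq_mul, Pi.zero_apply, Ideal.Quotient.eq_zero_iff_mem]
      exact P.mul_mem_right _ hpP
    · rw [map_nsmul, Nat.cast_smul_eq_nsmul]
  have h2 := Submodule.smul_mem _ (p : ℝ)⁻¹ h1
  rwa [inv_smul_smul₀ (by exact_mod_cast hp)] at h2

theorem exists_norm_sub_sq_le_of_codeLattice_top (P : Ideal (𝓞 (CyclotomicField m ℚ)))
    (z : CyclotomicPlane m) :
    ∃ x ∈ codeLattice P ⊤, ‖z - x‖ ^ 2 ≤ (m.totient : ℝ) ^ 2 / 2 := by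
  obtain ⟨t, rfl⟩ := exists_eq_sum_zetaVector m z
  obtain ⟨x, hx, h⟩ := exists_norm_sub_sq_le (codeLattice P ⊤)
    (fun ji => integerPlaneHom m (zetaVector m ji))
    (fun ji => mem_codeLattice.2 ⟨_, Submodule.mem_top, rfl⟩) t Finset.univ
  refine ⟨x, hx, h.trans (le_of_eq ?_)⟩
  simp_rw [norm_sq_zetaVector]
  simp
  ring

theorem exists_finset_of_mem_codeLattice {P : Ideal (𝓞 (CyclotomicField m ℚ))}
    {C : Submodule (𝓞 (CyclotomicField m ℚ) ⧸ P) (Fin 2 → 𝓞 (CyclotomicField m ℚ) ⧸ P)}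
    {v : CyclotomicPlane m} (hv : v ∈ codeLattice P C) (hv0 : v ≠ 0) :
    ∃ T : Finset (CyclotomicPlane m), T.card = m ∧
      ∀ y ∈ T, y ∈ codeLattice P C ∧ y ≠ 0 ∧ ‖y‖ = ‖v‖ := by
  classical
  obtain ⟨a, ha, rfl⟩ := mem_codeLattice.1 hv
  have ha0 : a ≠ 0 := by
    rintro rfl
    exact hv0 (map_zero _)
  obtain ⟨j, hj⟩ := Function.ne_iff.1 ha0
  refine ⟨(Finset.range m).image fun i => integerPlaneHom m (integerZeta m ^ i • a), ?_, ?_⟩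
  · rw [Finset.card_image_of_injOn, Finset.card_range]
    intro i hi i' hi' h
    have h1 := congrFun (integerPlaneHom_injective m h) j
    simp only [Pi.smul_apply, smul_eq_mul] at h1
    exact (integerZeta_isPrimitiveRoot m).pow_inj (by simpa using hi) (by simpa using hi')
      (mul_right_cancel₀ hj h1)
  · intro y hy
    simp only [Finset.mem_image] at hy
    obtain ⟨i, -, rfl⟩ := hy
    have hn := norm_integerPlaneHom_integerZeta_pow_smul m i a
    refine ⟨mem_codeLattice.2 ⟨_, ?_, rfl⟩, ?_, hn⟩
    · have := C.smul_mem (Ideal.Quotient.mk P (integerZeta m ^ i)) ha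
      convert! this using 1
    · rw [← norm_ne_zero_iff, hn, norm_ne_zero_iff]
      exact hv0

/-- The line of `F²` through `(1, c)`. -/
def slopeLine {F : Type*} [CommRing F] (c : F) : Submodule F (Fin 2 → F) :=
  Submodule.span F {![1, c]}

theorem mem_slopeLine {F : Type*} [CommRing F] {c : F} {w : Fin 2 → F} :
    w ∈ slopeLine c ↔ w 1 = c * w 0 := by
  rw [slopeLine, Submodule.mem_span_singleton]
  constructor
  · rintro ⟨k, rfl⟩
    simp [mul_comm]
  · intro h
    refine ⟨w 0, ?_⟩
    ext i
    fin_cases i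
    · simp
    · simp [h, mul_comm]

theorem finrank_slopeLine {F : Type*} [CommRing F] [Nontrivial F] (c : F) :
    Module.finrank F (slopeLine c) = 1 := by
  have hi : Function.Injective (LinearMap.toSpanSingleton F (Fin 2 → F) ![1, c]) := fun x y h => by
    simpa using congrFun h 0
  rw [slopeLine, ← LinearMap.range_toSpanSingleton, LinearMap.finrank_range_of_inj hi,
    Module.finrank_self]

theorem codeLattice_toAddSubgroup (P : Ideal (𝓞 (CyclotomicField m ℚ)))
    (C : Submodule (𝓞 (CyclotomicField m ℚ) ⧸ P) (Fin 2 → 𝓞 (CyclotomicField m ℚ) ⧸ P)) :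
    (codeLattice P C).toAddSubgroup = (C.toAddSubgroup.comap
      (AddMonoidHom.compLeft (Ideal.Quotient.mk P : _ →+ _) (Fin 2))).map (integerPlaneHom m) := by
  ext v
  rw [Submodule.mem_toAddSubgroup, mem_codeLattice]
  exact exists_congr fun a => and_congr_right fun _ => eq_comm

theorem relIndex_codeLattice_slopeLine (P : Ideal (𝓞 (CyclotomicField m ℚ)))
    (c : 𝓞 (CyclotomicField m ℚ) ⧸ P) :
    (codeLattice P (slopeLine c)).toAddSubgroup.relIndex (codeLattice P ⊤).toAddSubgroup =
      Nat.card (𝓞 (CyclotomicField m ℚ) ⧸ P) := by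
  rw [codeLattice_toAddSubgroup, codeLattice_toAddSubgroup,
    AddSubgroup.relIndex_map_map_of_injective _ _ (integerPlaneHom_injective m),
    Submodule.top_toAddSubgroup, AddSubgroup.comap_top, AddSubgroup.relIndex_top_right]
  let g : (Fin 2 → 𝓞 (CyclotomicField m ℚ)) →+ 𝓞 (CyclotomicField m ℚ) ⧸ P :=
    { toFun a := Ideal.Quotient.mk P (a 1) - c * Ideal.Quotient.mk P (a 0)
      map_zero' := by simp
      map_add' a b := by
        simp only [Pi.add_apply, map_add]
        ring }
  have hg : Function.Surjective g := fun y => by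
    obtain ⟨x, rfl⟩ := Ideal.Quotient.mk_surjective y
    exact ⟨![0, x], by simp [g]⟩
  have hker : (slopeLine c).toAddSubgroup.comap
      (AddMonoidHom.compLeft (Ideal.Quotient.mk P : _ →+ _) (Fin 2)) = g.ker := by
    ext a
    rw [AddSubgroup.mem_comap, Submodule.mem_toAddSubgroup, mem_slopeLine, AddMonoidHom.mem_ker]
    exact sub_eq_zero.symm
  rw [hker, AddSubgroup.index_ker, AddMonoidHom.range_eq_top.2 hg]
  exact Nat.card_congr AddSubgroup.topEquiv.toEquiv

end CyclotomicLattices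

theorem exists_mem_lineLatticeFamily_density_ge {m : ℕ} [NeZero m]
    {P : Ideal (𝓞 (CyclotomicField m ℚ))} (hP : IsPrimeAwayFromConductor P) {ε : ℝ}
    (hε0 : 0 < ε) (hε1 : ε < 1) (hm : 1 ≤ (1 - ε) * m)
    (hQ1 : 8 * (m.totient : ℝ) ^ 3 / ε ^ 2 ≤
      (Nat.card (𝓞 (CyclotomicField m ℚ) ⧸ P) : ℝ) ^ (1 / (m.totient : ℝ)))
    (hQ2 : (m.totient : ℝ) ^ 2 * m <
      (Nat.card (𝓞 (CyclotomicField m ℚ) ⧸ P) : ℝ) ^ (1 / (m.totient : ℝ))) :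
    ∃ L ∈ lineLatticeFamily P, IsEuclideanLattice L ∧
      (1 - ε) * m / 2 ^ (2 * m.totient) ≤ latticeDensity L := by
  obtain ⟨hprime, p, hp, -, hpP⟩ := hP
  have hd : 1 ≤ m.totient := Nat.totient_pos.2 (NeZero.pos m)
  have hP0 : P ≠ ⊥ := by
    rintro rfl
    exact hp.ne_zero (by exact_mod_cast (Submodule.mem_bot _).1 hpP)
  have : Finite (𝓞 (CyclotomicField m ℚ) ⧸ P) := Ideal.finiteQuotientOfFreeOfNeBot P hP0
  let _ : Fintype (𝓞 (CyclotomicField m ℚ) ⧸ P) := Fintype.ofFinite _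
  have := fun C => isZLattice_codeLattice hp.ne_zero hpP C
  have hQ : ((Nat.card (𝓞 (CyclotomicField m ℚ) ⧸ P) : ℝ) ^ (1 / (m.totient : ℝ))) ^ m.totient =
      Nat.card (𝓞 (CyclotomicField m ℚ) ⧸ P) := by
    rw [one_div]
    exact Real.rpow_inv_natCast_pow (Nat.cast_nonneg _) (by omega)
  obtain ⟨c, hc⟩ := exists_latticeDensity_ge_of_le (codeLattice P ⊤)
    (fun c => codeLattice P (slopeLine c)) (fun c => codeLattice_mono le_top)
    (fun c => by rw [relIndex_codeLattice_slopeLine, Nat.card_eq_fintype_card])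
    (fun c v hv hv0 => exists_finset_of_mem_codeLattice hv hv0) hd (finrank_cyclotomicPlane m)
    (fun v hv hv0 => totient_le_norm_sq_of_mem_codeLattice hv hv0)
    (exists_norm_sub_sq_le_of_codeLattice_top P) (by positivity)
    (hQ.trans (by rw [Nat.card_eq_fintype_card])) (fun c c' hcc v hv hv' hv0 => by
      obtain ⟨a, ha, rfl⟩ := mem_codeLattice.1 hv
      obtain ⟨a', ha', haa⟩ := mem_codeLattice.1 hv'
      obtain rfl := integerPlaneHom_injective m haa
      rw [mem_slopeLine] at ha ha'
      have h0 : Ideal.Quotient.mk P (a 0) = 0 := by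
        have h := ha.symm.trans ha'
        rw [← sub_eq_zero, ← sub_mul] at h
        exact (mul_eq_zero.1 h).resolve_left (sub_ne_zero.2 hcc)
      have h1 : Ideal.Quotient.mk P (a 1) = 0 := by rw [ha, h0, mul_zero]
      have hmem : ∀ i, a i ∈ P := fun i => by
        rw [← Ideal.Quotient.eq_zero_iff_mem]
        fin_cases i
        · exact h0
        · exact h1
      refine totient_mul_sq_le_norm_sq_integerPlaneHom m ?_ (by positivity) fun i hi => ?_
      · rintro rfl
        exact hv0 (map_zero _)
      · rw [hQ]
        exact_mod_cast card_quotient_le_natAbs_norm (hmem i) hi)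
    hε0 hε1 hm hQ1 hQ2
  exact ⟨_, ⟨_, finrank_slopeLine c, rfl⟩, ⟨inferInstance, IsZLattice.span_top⟩, hc⟩

theorem eventually_hasDenseLineLattice
    {P : ∀ X : ℕ, Ideal (𝓞 (CyclotomicField (primorial X) ℚ))} (hP : IsAdmissibleChoice P) :
    ∀ᶠ X : ℕ in atTop, HasDenseLineLattice (P X) := by
  obtain ⟨hP, ho⟩ := hP
  filter_upwards [eventually_log_log_le_primorial, eventually_ge_atTop 2,
    ho.bound (c := 0.0001 ^ 2 / 8) (by norm_num)] with X hX hX2 hQ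
  set d := (primorial X).totient
  set Q := (Nat.card (𝓞 (CyclotomicField (primorial X) ℚ) ⧸ P X) : ℝ) ^ (1 / (d : ℝ)) with hQdef
  rw [Real.norm_of_nonneg (by positivity), Real.norm_of_nonneg (by positivity)] at hQ
  have hm2 : (2 : ℝ) ≤ primorial X := by
    exact_mod_cast primorial_two ▸ primorial_mono hX2
  have hd : (1 : ℝ) ≤ d := by exact_mod_cast Nat.totient_pos.2 (primorial_pos X)
  have hdm : (d : ℝ) ≤ primorial X := by exact_mod_cast Nat.totient_le _
  have hpos : 0 < (d : ℝ) ^ 2 * primorial X := by positivity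
  have hd3 : (d : ℝ) ^ 3 ≤ (d : ℝ) ^ 2 * primorial X := by
    rw [pow_succ]
    gcongr
  obtain ⟨L, hL, hlat, hdens⟩ := exists_mem_lineLatticeFamily_density_ge (hP X) (ε := 0.0001)
    (by norm_num) (by norm_num) (by linarith)
    (by
      rw [div_le_iff₀ (by norm_num)]
      linarith) (by
      refine lt_of_le_of_lt hQ ?_
      have : 0 < Q := by nlinarith
      linarith)
  refine ⟨L, hL, hlat, le_trans ?_ hdens⟩
  refine div_le_div_of_nonneg_right ?_ (by positivity)
  set l := Real.log (Real.log (2 * d : ℕ))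
  push_cast
  rcases le_or_gt 0 l with hl | hl
  · nlinarith [mul_nonneg hl (by linarith : (0 : ℝ) ≤ d)]
  · nlinarith [mul_pos_of_neg_of_neg hl (by linarith : -(d : ℝ) < 0)]

theorem exists_isPrime_card_quotient_ge {K : Type*} [Field K] [NumberField K] {p : ℕ}
    (hp : p.Prime) : ∃ P : Ideal (𝓞 K), P.IsPrime ∧ (p : 𝓞 K) ∈ P ∧ p ≤ Nat.card (𝓞 K ⧸ P) := by
  have hne : Ideal.span {(p : 𝓞 K)} ≠ ⊤ := by
    intro h
    have h1 := congrArg Ideal.absNorm h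
    rw [Ideal.absNorm_span_singleton, Ideal.absNorm_top, ← map_natCast (algebraMap ℤ (𝓞 K)),
      Algebra.norm_algebraMap] at h1
    simp [hp.ne_one, Module.finrank_pos.ne'] at h1
  obtain ⟨P, hP, hle⟩ := Ideal.exists_le_maximal _ hne
  have hpP : (p : 𝓞 K) ∈ P := hle (Ideal.mem_span_singleton_self _)
  have hP0 : P ≠ ⊥ := by
    rintro rfl
    exact hp.ne_zero (by exact_mod_cast (Submodule.mem_bot _).1 hpP)
  have : Finite (𝓞 K ⧸ P) := Ideal.finiteQuotientOfFreeOfNeBot P hP0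
  refine ⟨P, hP.isPrime, hpP, Nat.le_of_dvd Nat.card_pos ?_⟩
  by_contra hdvd
  have hq : ((Nat.card (𝓞 K ⧸ P) : ℕ) : 𝓞 K) ∈ P := by
    rw [← Ideal.Quotient.eq_zero_iff_mem, map_natCast, ← nsmul_one]
    exact card_nsmul_eq_zero'
  obtain ⟨u, v, huv⟩ := (Nat.isCoprime_iff_coprime.2 ((hp.coprime_iff_not_dvd).2 hdvd))
  apply hP.ne_top
  rw [Ideal.eq_top_iff_one]
  have h1 := congrArg (fun z : ℤ => (z : 𝓞 K)) huv
  push_cast at h1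
  rw [← h1]
  exact P.add_mem (P.mul_mem_left _ hpP) (P.mul_mem_left _ hq)

theorem exists_isAdmissibleChoice :
    ∃ P : ∀ X : ℕ, Ideal (𝓞 (CyclotomicField (primorial X) ℚ)), IsAdmissibleChoice P := by
  have h : ∀ X : ℕ, ∃ P : Ideal (𝓞 (CyclotomicField (primorial X) ℚ)),
      IsPrimeAwayFromConductor P ∧
      ((primorial X).totient ^ 2 * primorial X * (X + 1)) ^ (primorial X).totient ≤
        Nat.card (𝓞 (CyclotomicField (primorial X) ℚ) ⧸ P) := fun X => by
    obtain ⟨p, hle, hp⟩ := Nat.exists_infinite_primes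
      (max (primorial X + 1)
        (((primorial X).totient ^ 2 * primorial X * (X + 1)) ^ (primorial X).totient))
    obtain ⟨P, hP, hpP, hcard⟩ :=
      exists_isPrime_card_quotient_ge (K := CyclotomicField (primorial X) ℚ) hp
    refine ⟨P, ⟨hP, p, hp, fun hdvd => ?_, hpP⟩, (le_max_right _ _).trans (hle.trans hcard)⟩
    have h1 := Nat.le_of_dvd (primorial_pos X) hdvd
    have h2 := (le_max_left _ _).trans hle
    omega
  choose P hP hcard using h
  refine ⟨P, hP, isLittleO_iff.2 fun c hc => ?_⟩
  filter_upwards [tendsto_natCast_atTop_atTop.eventually_ge_atTop (1 / c)] with X hX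
  set d := (primorial X).totient
  have hd : d ≠ 0 := (Nat.totient_pos.2 (primorial_pos X)).ne'
  rw [Real.norm_of_nonneg (by positivity), Real.norm_of_nonneg (by positivity)]
  have h1 : (d : ℝ) ^ 2 * primorial X * (X + 1) ≤
      (Nat.card (𝓞 (CyclotomicField (primorial X) ℚ) ⧸ P X) : ℝ) ^ (1 / (d : ℝ)) := by
    rw [one_div]
    refine (Real.le_rpow_inv_iff_of_pos (by positivity) (by positivity) (by positivity)).2 ?_
    rw [Real.rpow_natCast]
    exact_mod_cast hcard X
  have h2 : 1 ≤ c * (X + 1) := by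
    rw [div_le_iff₀ hc] at hX
    nlinarith
  calc (d : ℝ) ^ 2 * primorial X ≤ (d : ℝ) ^ 2 * primorial X * (c * (X + 1)) :=
        le_mul_of_one_le_right (by positivity) h2
    _ = c * ((d : ℝ) ^ 2 * primorial X * (X + 1)) := by ring
    _ ≤ _ := mul_le_mul_of_nonneg_left h1 hc.le

theorem tendsto_totient_primorial : Tendsto (fun X => (primorial X).totient) atTop atTop := by
  refine tendsto_atTop.2 fun N => ?_
  obtain ⟨p, hle, hp⟩ := Nat.exists_infinite_primes (N + 1)
  filter_upwards [eventually_ge_atTop p] with X hX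
  have hdvd : p ∣ primorial X := Finset.dvd_prod_of_mem _ (Nat.mem_primesLE.2 ⟨hX, hp⟩)
  have h1 := Nat.le_of_dvd (Nat.totient_pos.2 (primorial_pos X)) (Nat.totient_dvd_of_dvd hdvd)
  rw [Nat.totient_prime hp] at h1
  omega

theorem mainTheorem3 :
    (∃ P : ∀ X : ℕ, Ideal (𝓞 (CyclotomicField (primorial X) ℚ)), IsAdmissibleChoice P) ∧
    ∀ P : ∀ X : ℕ, Ideal (𝓞 (CyclotomicField (primorial X) ℚ)), IsAdmissibleChoice P →
      (∀ᶠ X : ℕ in atTop, HasDenseLineLattice (P X)) ∧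
      {n : ℕ | ∃ X : ℕ, n = 2 * (primorial X).totient ∧ HasDenseLineLattice (P X)}.Infinite := by
  refine ⟨exists_isAdmissibleChoice, fun P hP => ?_⟩
  have h := eventually_hasDenseLineLattice hP
  refine ⟨h, Set.infinite_of_forall_exists_gt fun N => ?_⟩
  obtain ⟨X, hX, hN⟩ := (h.and (tendsto_totient_primorial.eventually_gt_atTop N)).exists
  exact ⟨_, ⟨X, rfl, hX⟩, by omega⟩
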